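/- Consider the two-factor crossed random effects model $Y_{ij}=\mu+a_i+b_j+e_{ij}$, $i,j\in\mathbb N$, where all the random variables $a_i$, $b_j$, $e_{ij}$ are mutually independent, the $a_i$ are identically distributed with mean $0$, variance $\sigma_A^2$ and $\mathbb E(a_i^4)<\infty$, the $b_j$ likewise with variance $\sigma_B^2$, and the $e_{ij}$ likewise with variance $\sigma_E^2$. Let $\kappa_A,\kappa_B,\kappa_E$ be their (excess) kurtoses, so that $\mathbb E(a_i^4)=(\kappa_A+3)\sigma_A^4$, $\mathbb E(b_j^4)=(\kappa_B+3)\sigma_B^4$, $\mathbb E(e_{ij}^4)=(\kappa_E+3)\sigma_E^4$ (if a variance is $0$, the corresponding kurtosis may be any real number). Let $Z_{ij}\in\{0,1\}$ be an arbitrary fixed pattern, with $Z_{ij}=1$ if $Y_{ij}$ is observed, such that $N=\sum_{ij}Z_{ij}$ satisfies $1\le N<\infty$. Let $N_{i\bullet}=\sum_jZ_{ij}$, $N_{\bullet j}=\sum_iZ_{ij}$; let $R$ be the number of rows $i$ with $N_{i\bullet}>0$ and $C$ the number of columns $j$ with $N_{\bullet j}>0$. All sums over rows ($i,i',r$) run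 over the rows with $N_{i\bullet}>0$ only, and all sums over columns ($j,j',s$) run over the columns with $N_{\bullet j}>0$ only. Put $(ZZ^{\mathsf T})_{ir}=\sum_jZ_{ij}Z_{rj}$, $(Z^{\mathsf T}Z)_{js}=\sum_iZ_{ij}Z_{is}$, $T_{i\bullet}=\sum_jZ_{ij}N_{\bullet j}$, $T_{\bullet j}=\sum_iZ_{ij}N_{i\bullet}$, and $$U_a=\tfrac12\sum_{ijj'}N_{i\bullet}^{-1}Z_{ij}Z_{ij'}(Y_{ij}-Y_{ij'})^2,\quad U_b=\tfrac12\sum_{jii'}N_{\bullet j}^{-1}Z_{ij}Z_{i'j}(Y_{ij}-Y_{i'j})^2,\quad U_e=\tfrac12\sum_{iji'j'}Z_{ij}Z_{i'j'}(Y_{ij}-Y_{i'j'})^2.$$ Then $U_a,U_b,U_e$ are square integrable, with variances $$\begin{aligned}\mathrm{Var}(U_a)={}&\sigma_B^4(\kappa_B+2)\sum_{ir}(ZZ^{\mathsf T})_{ir}(1-N_{i\bullet}^{-1})(1-N_{r\bullet}^{-1})+2\sigma_B^4\sum_{ir}N_{i\bullet}^{-1}N_{r\bullet}^{-1}(ZZ^{\mathsf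 T})_{ir}\bigl((ZZ^{\mathsf T})_{ir}-1\bigr)\\&+4\sigma_B^2\sigma_E^2(N-R)+\sigma_E^4(\kappa_E+2)\sum_iN_{i\bullet}(1-N_{i\bullet}^{-1})^2+2\sigma_E^4\sum_i(1-N_{i\bullet}^{-1}),\end{aligned}$$ $$\begin{aligned}\mathrm{Var}(U_b)={}&\sigma_A^4(\kappa_A+2)\sum_{js}(Z^{\mathsf T}Z)_{js}(1-N_{\bullet j}^{-1})(1-N_{\bullet s}^{-1})+2\sigma_A^4\sum_{js}N_{\bullet j}^{-1}N_{\bullet s}^{-1}(Z^{\mathsf T}Z)_{js}\bigl((Z^{\mathsf T}Z)_{js}-1\bigr)\\&+4\sigma_A^2\sigma_E^2(N-C)+\sigma_E^4(\kappa_E+2)\sum_jN_{\bullet j}(1-N_{\bullet j}^{-1})^2+2\sigma_E^4\sum_j(1-N_{\bullet j}^{-1}),\end{aligned}$$ $$\begin{aligned}\mathrm{Var}(U_e)={}&2\sigma_A^4\Bigl(\bigl(\sum_iN_{i\bullet}^2\bigr)^2-\sum_iN_{i\bullet}^4\Bigr)+\sigma_A^4(\kappa_A+2)\Bigl(N^2\sum_iN_{i\bullet}^2-2N\sum_iN_{i\bullet}^3+\sum_iN_{i\bullet}^4\Bigr)\\&+2\sigma_B^4\Bigl(\bigl(\sum_jN_{\bullet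 j}^2\bigr)^2-\sum_jN_{\bullet j}^4\Bigr)+\sigma_B^4(\kappa_B+2)\Bigl(N^2\sum_jN_{\bullet j}^2-2N\sum_jN_{\bullet j}^3+\sum_jN_{\bullet j}^4\Bigr)\\&+2\sigma_E^4N(N-1)+\sigma_E^4(\kappa_E+2)N(N-1)^2\\&+4\sigma_A^2\sigma_B^2\Bigl(N^3-2N\sum_{ij}Z_{ij}N_{i\bullet}N_{\bullet j}+\sum_{ij}N_{i\bullet}^2N_{\bullet j}^2\Bigr)\\&+4\sigma_A^2\sigma_E^2\Bigl(N^3-N\sum_iN_{i\bullet}^2\Bigr)+4\sigma_B^2\sigma_E^2\Bigl(N^3-N\sum_jN_{\bullet j}^2\Bigr),\end{aligned}$$ and covariances $$\mathrm{Cov}(U_a,U_b)=\sigma_E^4(\kappa_E+2)\sum_{ij}Z_{ij}(1-N_{i\bullet}^{-1})(1-N_{\bullet j}^{-1}),$$ $$\begin{aligned}\mathrm{Cov}(U_a,U_e)={}&2\sigma_B^4\Bigl(\sum_iN_{i\bullet}^{-1}T_{i\bullet}^2-\sum_{ij}Z_{ij}N_{i\bullet}^{-1}N_{\bullet j}^2\Bigr)+\sigma_B^4(\kappa_B+2)\sum_{ij}Z_{ij}(N-N_{\bullet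 j})N_{\bullet j}(1-N_{i\bullet}^{-1})\\&+2\sigma_E^4(N-R)+\sigma_E^4(\kappa_E+2)(N-R)(N-1)+4\sigma_B^2\sigma_E^2N(N-R),\end{aligned}$$ $$\begin{aligned}\mathrm{Cov}(U_b,U_e)={}&2\sigma_A^4\Bigl(\sum_jN_{\bullet j}^{-1}T_{\bullet j}^2-\sum_{ij}Z_{ij}N_{\bullet j}^{-1}N_{i\bullet}^2\Bigr)+\sigma_A^4(\kappa_A+2)\sum_{ij}Z_{ij}(N-N_{i\bullet})N_{i\bullet}(1-N_{\bullet j}^{-1})\\&+2\sigma_E^4(N-C)+\sigma_E^4(\kappa_E+2)(N-C)(N-1)+4\sigma_A^2\sigma_E^2N(N-C).\end{aligned}$$ -/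

import Mathlib

open MeasureTheory ProbabilityTheory

noncomputable section

/-- A pattern of observations `Z` with `1 ≤ N < ∞`: `Z i j = 1` if the value in row `i` and column
`j` is observed and `Z i j = 0` otherwise; finitely many, and at least one, are observed. -/
structure ObservationPattern where
  /-- the indicator of being observed -/
  Z : ℕ → ℕ → ℝ
  zero_or_one : ∀ i j, Z i j = 0 ∨ Z i j = 1
  finite_observed : {p : ℕ × ℕ | Z p.1 p.2 = 1}.Finite
  exists_observed : ∃ i j, Z i j = 1

namespace ObservationPattern

variable (O : ObservationPattern)

/-- The finite set of rows that hold at least one observation. -/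
def rows : Finset ℕ := O.finite_observed.toFinset.image Prod.fst

/-- The finite set of columns that hold at least one observation. -/
def cols : Finset ℕ := O.finite_observed.toFinset.image Prod.snd

/-- The sample size. -/
def N : ℝ := ∑ i ∈ O.rows, ∑ j ∈ O.cols, O.Z i j

/-- The number of observations in row `i`. -/
def rowCount (i : ℕ) : ℝ := ∑ j ∈ O.cols, O.Z i j

/-- The number of observations in column `j`. -/
def colCount (j : ℕ) : ℝ := ∑ i ∈ O.rows, O.Z i j

/-- The number of distinct rows with data. -/
def R : ℝ := (O.rows.card : ℝ)

/-- The number of distinct columns with data. -/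
def C : ℝ := (O.cols.card : ℝ)

/-- The entries of `Z Zᵀ`: the number of columns with data in both rows `i` and `r`. -/
def ZZt (i r : ℕ) : ℝ := ∑ j ∈ O.cols, O.Z i j * O.Z r j

/-- The entries of `Zᵀ Z`: the number of rows with data in both columns `j` and `s`. -/
def ZtZ (j s : ℕ) : ℝ := ∑ i ∈ O.rows, O.Z i j * O.Z i s

/-- The total number of observations in the columns that are represented in row `i`. -/
def rowT (i : ℕ) : ℝ := ∑ j ∈ O.cols, O.Z i j * O.colCount j

/-- The total number of observations in the rows that are represented in column `j`. -/
def colT (j : ℕ) : ℝ := ∑ i ∈ O.rows, O.Z i j * O.rowCount i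

/-- The within-row `U`-statistic. -/
def Ua {Ω : Type*} (Y : ℕ → ℕ → Ω → ℝ) (ω : Ω) : ℝ :=
  (1 / 2) * ∑ i ∈ O.rows, ∑ j ∈ O.cols, ∑ j' ∈ O.cols,
    (O.rowCount i)⁻¹ * O.Z i j * O.Z i j' * (Y i j ω - Y i j' ω) ^ 2

/-- The within-column `U`-statistic. -/
def Ub {Ω : Type*} (Y : ℕ → ℕ → Ω → ℝ) (ω : Ω) : ℝ :=
  (1 / 2) * ∑ j ∈ O.cols, ∑ i ∈ O.rows, ∑ i' ∈ O.rows,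
    (O.colCount j)⁻¹ * O.Z i j * O.Z i' j * (Y i j ω - Y i' j ω) ^ 2

/-- The overall `U`-statistic. -/
def Ue {Ω : Type*} (Y : ℕ → ℕ → Ω → ℝ) (ω : Ω) : ℝ :=
  (1 / 2) * ∑ i ∈ O.rows, ∑ j ∈ O.cols, ∑ i' ∈ O.rows, ∑ j' ∈ O.cols,
    O.Z i j * O.Z i' j' * (Y i j ω - Y i' j' ω) ^ 2

end ObservationPattern

/-- The random variables `X k` are identically distributed with mean `0`, variance `v = σ²`, finite
fourth moment and (excess) kurtosis `κ`, that is `E[X⁴] = (κ + 3) σ⁴`. For `v ≠ 0` the latter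
determines `κ = E[X⁴] / σ⁴ - 3`. -/
structure IdenticalEffects {Ω : Type*} [MeasurableSpace Ω] (P : Measure Ω) {ι : Type*}
    (X : ι → Ω → ℝ) (v κ : ℝ) : Prop where
  measurable : ∀ k, Measurable (X k)
  identDistrib : ∀ k l, IdentDistrib (X k) (X l) P P
  mean_eq : ∀ k, ∫ ω, X k ω ∂P = 0
  variance_eq : ∀ k, Var[X k; P] = v
  integrable_fourth : ∀ k, Integrable (fun ω => X k ω ^ 4) P
  fourth_moment_eq : ∀ k, ∫ ω, X k ω ^ 4 ∂P = (κ + 3) * v ^ 2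

/-- The two-factor crossed random effects model `Y i j = m + a i + b j + e i j`: all the random
variables `a i`, `b j`, `e i j` are mutually independent, and each of the three families is
identically distributed with mean `0`, variance `vA`, `vB`, `vE` (that is `σ_A²`, `σ_B²`, `σ_E²`),
kurtosis `κA`, `κB`, `κE`, and finite fourth moment. -/
structure CrossedRandomEffects {Ω : Type*} [MeasurableSpace Ω] (P : Measure Ω)
    (Y : ℕ → ℕ → Ω → ℝ) (m : ℝ) (a b : ℕ → Ω → ℝ) (e : ℕ → ℕ → Ω → ℝ)
    (vA vB vE κA κB κE : ℝ) : Prop where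
  response_eq : ∀ i j ω, Y i j ω = m + a i ω + b j ω + e i j ω
  indep : iIndepFun (Sum.elim a (Sum.elim b (fun p : ℕ × ℕ => e p.1 p.2))) P
  row_effects : IdenticalEffects P a vA κA
  col_effects : IdenticalEffects P b vB κB
  errors : IdenticalEffects P (fun p : ℕ × ℕ => e p.1 p.2) vE κE

end

/-!
Every response is `m` plus a sum of independent centred effects, and each of the three statistics is
a weighted sum of squared differences of responses. Hence each is a quadratic form in the effects:
by Lagrange's identity it is a sum of squares minus squares of (row, column or grand) totals, and
`m` cancels (`Ua_eq_quadForm`, `Ub_eq_quadForm`, `Ue_eq_quadForm`).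

For independent centred variables, a mixed fourth moment vanishes as soon as one of the variables
occurs only once in it. This leaves few terms in the covariance of two quadratic forms
(`IndependentEffects.covariance_quadForm`): each product of two distinct effects contributes twice
the product of its coefficients and the two variances, and each square contributes `κ + 2` times the
product of its coefficients and the squared variance. This is where the factors `2 σ⁴`,
`σ⁴ (κ + 2)` and, because a pair of different kinds of effects occurs in both orders, `4 σ² σ'²` of
the formulas come from (`CrossedRandomEffects.covariance_quadForm`). What remains is to evaluate
sums of products of coefficients, with `Z i j ^ 2 = Z i j` and with the row counts nonzero. The
within-column formulas follow from the within-row ones by transposing the pattern and the model.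
-/

/-! ### Quadratic forms in independent variables -/

/-- Mutually independent, centred random variables `X k` with variances `v k`, finite fourth moments
and excess kurtoses `κ k`; they need not be identically distributed. -/
structure IndependentEffects {Ω : Type*} [MeasurableSpace Ω] (P : Measure Ω) {ι : Type*}
    (X : ι → Ω → ℝ) (v κ : ι → ℝ) : Prop where
  indep : iIndepFun X P
  measurable : ∀ k, Measurable (X k)
  memLp_four : ∀ k, MemLp (X k) 4 P
  mean_eq : ∀ k, ∫ ω, X k ω ∂P = 0
  sq_moment_eq : ∀ k, ∫ ω, X k ω ^ 2 ∂P = v k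
  fourth_moment_eq : ∀ k, ∫ ω, X k ω ^ 4 ∂P = (κ k + 3) * v k ^ 2

namespace IndependentEffects

variable {Ω : Type*} [MeasurableSpace Ω] {P : Measure Ω} {ι : Type*}
  {X : ι → Ω → ℝ} {v κ : ι → ℝ}

theorem memLp_mul (h : IndependentEffects P X v κ) (k l : ι) :
    MemLp (fun ω => X k ω * X l ω) 2 P := by
  have : ENNReal.HolderTriple 4 4 2 := ⟨by
    rw [show (4 : ENNReal) = 2 * 2 by norm_num, ENNReal.mul_inv (by simp) (by simp), ← mul_add,
      ENNReal.inv_two_add_inv_two, mul_one]⟩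
  exact (h.memLp_four l).mul' (h.memLp_four k)

theorem integral_mul_of_ne (h : IndependentEffects P X v κ) {k l : ι} (hkl : k ≠ l) :
    ∫ ω, X k ω * X l ω ∂P = 0 := by
  rw [(h.indep.indepFun hkl).integral_fun_mul_eq_mul_integral
    (h.measurable k).aestronglyMeasurable (h.measurable l).aestronglyMeasurable, h.mean_eq,
    zero_mul]

theorem integral_sq_mul_sq (h : IndependentEffects P X v κ) {k l : ι} (hkl : k ≠ l) :
    ∫ ω, X k ω ^ 2 * X l ω ^ 2 ∂P = v k * v l := by
  have hI : IndepFun (fun ω => X k ω ^ 2) (fun ω => X l ω ^ 2) P :=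
    (h.indep.indepFun hkl).comp (φ := fun x : ℝ => x ^ 2) (ψ := fun x : ℝ => x ^ 2)
      (by fun_prop) (by fun_prop)
  rw [hI.integral_fun_mul_eq_mul_integral
    ((h.measurable k).pow_const 2).aestronglyMeasurable
    ((h.measurable l).pow_const 2).aestronglyMeasurable, h.sq_moment_eq, h.sq_moment_eq]

/-- A mixed moment vanishes when one of the variables occurs only once in it. -/
theorem integral_mul_mul_mul_of_ne (h : IndependentEffects P X v κ) {k l p q : ι}
    (hl : k ≠ l) (hp : k ≠ p) (hq : k ≠ q) :
    ∫ ω, X k ω * (X l ω * X p ω * X q ω) ∂P = 0 := by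
  classical
  have hI := h.indep.indepFun_finset {k} {l, p, q} (by simp [hl, hp, hq]) h.measurable
  have hJ : IndepFun (X k) (fun ω => X l ω * X p ω * X q ω) P :=
    hI.comp (φ := fun x : ({k} : Finset ι) → ℝ => x ⟨k, by simp⟩)
      (ψ := fun x : ({l, p, q} : Finset ι) → ℝ =>
        x ⟨l, by simp⟩ * x ⟨p, by simp⟩ * x ⟨q, by simp⟩) (by fun_prop) (by fun_prop)
  have hm := h.measurable
  rw [hJ.integral_fun_mul_eq_mul_integral (hm k).aestronglyMeasurable
    (by fun_prop), h.mean_eq, zero_mul]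

/-- The covariances of the products of two variables. The first two terms are those of Gaussian
variables; the kurtosis enters only when all four indices agree. -/
theorem covariance_mul_mul [IsProbabilityMeasure P] [DecidableEq ι]
    (h : IndependentEffects P X v κ) (k l p q : ι) :
    cov[fun ω => X k ω * X l ω, fun ω => X p ω * X q ω; P] =
      (if p = k then if q = l then v k * v l else 0 else 0)
        + (if q = k then if p = l then v k * v l else 0 else 0)
        + (if p = k then if q = k then if l = k then κ k * v k ^ 2 else 0 else 0 else 0) := by
  have hsq : ∀ k, ∫ ω, X k ω * X k ω ∂P = v k := fun k => by
    simpa only [pow_two] using h.sq_moment_eq k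
  rw [covariance_eq_sub (h.memLp_mul k l) (h.memLp_mul p q)]
  simp only [Pi.mul_apply]
  by_cases hkl : l = k
  · subst hkl
    by_cases hpq : q = p
    · subst hpq
      by_cases hlq : q = l
      · subst hlq
        have h4 : ∫ ω, X q ω * X q ω * (X q ω * X q ω) ∂P = (κ q + 3) * v q ^ 2 := by
          rw [← h.fourth_moment_eq]; congr 1; ext ω; ring
        simp only [h4, hsq, if_true]; ring
      · have h22 : ∫ ω, X l ω * X l ω * (X q ω * X q ω) ∂P = v l * v q := by
          rw [← h.integral_sq_mul_sq (Ne.symm hlq)]; congr 1; ext ω; ring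
        simp [h22, hsq, hlq]
    · rw [h.integral_mul_of_ne (Ne.symm hpq), mul_zero, sub_zero]
      by_cases hp : p = l
      · subst hp
        simp only [if_neg hpq, if_true, add_zero]
        rw [← h.integral_mul_mul_mul_of_ne hpq hpq hpq]
        congr 1; ext ω; ring
      · simp only [if_neg hp, add_zero, ite_self]
        rw [← h.integral_mul_mul_mul_of_ne hp hp (Ne.symm hpq)]
        congr 1; ext ω; ring
  · rw [h.integral_mul_of_ne (Ne.symm hkl), zero_mul, sub_zero]
    simp only [if_neg hkl, ite_self, add_zero]
    by_cases hp : p = k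
    · subst hp
      simp only [if_neg (Ne.symm hkl), ite_self, add_zero, if_true]
      by_cases hq : q = l
      · subst hq
        rw [if_pos rfl, ← h.integral_sq_mul_sq (Ne.symm hkl)]
        congr 1; ext ω; ring
      · rw [if_neg hq, ← h.integral_mul_mul_mul_of_ne hkl hkl (Ne.symm hq)]
        congr 1; ext ω; ring
    · rw [if_neg hp, zero_add]
      by_cases hq : q = k
      · subst hq
        rw [if_pos rfl]
        by_cases hl : p = l
        · subst hl
          rw [if_pos rfl, ← h.integral_sq_mul_sq (Ne.symm hkl)]
          congr 1; ext ω; ring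
        · rw [if_neg hl, ← h.integral_mul_mul_mul_of_ne hkl (Ne.symm hl) hkl]
          congr 1; ext ω; ring
      · rw [if_neg hq, ← h.integral_mul_mul_mul_of_ne (Ne.symm hkl) (Ne.symm hp) (Ne.symm hq)]
        congr 1; ext ω; ring

end IndependentEffects

/-- The quadratic form `∑ₖ d k (x k)² - ∑ₖₗ f k l (x k) (x l)` over a finite index set. -/
noncomputable def quadForm {ι : Type*} (S : Finset ι) (d : ι → ℝ) (f : ι → ι → ℝ) (x : ι → ℝ) : ℝ :=
  ∑ k ∈ S, d k * x k ^ 2 - ∑ k ∈ S, ∑ l ∈ S, f k l * (x k * x l)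

theorem quadForm_eq_sum {ι : Type*} [DecidableEq ι] (S : Finset ι) (d : ι → ℝ) (f : ι → ι → ℝ)
    (x : ι → ℝ) :
    quadForm S d f x =
      ∑ k ∈ S, ∑ l ∈ S, ((if l = k then d k else 0) - f k l) * (x k * x l) := by
  simp only [quadForm, sub_mul, Finset.sum_sub_distrib]
  congr 1
  refine Finset.sum_congr rfl fun k hk => ?_
  simp [ite_mul, hk, pow_two]

namespace IndependentEffects

variable {Ω : Type*} [MeasurableSpace Ω] {P : Measure Ω} {ι : Type*}
  {X : ι → Ω → ℝ} {v κ : ι → ℝ}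

theorem memLp_quadForm (h : IndependentEffects P X v κ) (S : Finset ι) (d : ι → ℝ)
    (f : ι → ι → ℝ) : MemLp (fun ω => quadForm S d f (fun k => X k ω)) 2 P := by
  classical
  simp only [quadForm_eq_sum]
  exact memLp_finsetSum _ fun k _ => memLp_finsetSum _ fun l _ => (h.memLp_mul k l).const_mul _

theorem covariance_sum_mul_mul [IsProbabilityMeasure P] (h : IndependentEffects P X v κ)
    (S : Finset ι) (M M' : ι → ι → ℝ) :
    cov[fun ω => ∑ k ∈ S, ∑ l ∈ S, M k l * (X k ω * X l ω),
        fun ω => ∑ k ∈ S, ∑ l ∈ S, M' k l * (X k ω * X l ω); P] =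
      ∑ k ∈ S, ∑ l ∈ S, v k * v l * M k l * (M' k l + M' l k)
        + ∑ k ∈ S, κ k * v k ^ 2 * M k k * M' k k := by
  classical
  have hM : ∀ (M : ι → ι → ℝ) (k l : ι), MemLp (fun ω => M k l * (X k ω * X l ω)) 2 P :=
    fun M k l => (h.memLp_mul k l).const_mul _
  rw [covariance_fun_sum_fun_sum' (fun k _ => memLp_finsetSum _ fun l _ => hM M k l)
    (fun k _ => memLp_finsetSum _ fun l _ => hM M' k l), ← Finset.sum_add_distrib]
  refine Finset.sum_congr rfl fun k hk => ?_
  have hkl : ∀ l ∈ S, ∑ p ∈ S, ∑ q ∈ S,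
      cov[fun ω => M k l * (X k ω * X l ω), fun ω => M' p q * (X p ω * X q ω); P] =
      v k * v l * M k l * (M' k l + M' l k)
        + if l = k then κ k * v k ^ 2 * M k k * M' k k else 0 := by
    intro l hl
    simp only [covariance_const_mul_left, covariance_const_mul_right, h.covariance_mul_mul,
      mul_add, mul_ite, mul_zero, Finset.sum_add_distrib, Finset.sum_ite_eq', hk, hl,
      Finset.sum_ite_irrel, Finset.sum_const_zero, if_true]
    split_ifs with hlk
    · subst hlk; ring
    · ring
  calc _ = ∑ l ∈ S, ∑ p ∈ S, ∑ q ∈ S,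
      cov[fun ω => M k l * (X k ω * X l ω), fun ω => M' p q * (X p ω * X q ω); P] := by
        rw [Finset.sum_comm]
        refine Finset.sum_congr rfl fun p _ => ?_
        rw [covariance_fun_sum_fun_sum' (fun l _ => hM M k l) (fun q _ => hM M' p q)]
    _ = _ := by
        rw [Finset.sum_congr rfl hkl, Finset.sum_add_distrib]
        simp [hk]

/-- The covariance of two quadratic forms: the off-diagonal coefficients contribute as for Gaussian
variables, while the diagonal ones carry the factor `κ + 2`, the relative variance of a square. -/
theorem covariance_quadForm [IsProbabilityMeasure P] (h : IndependentEffects P X v κ)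
    (S : Finset ι) (d d' : ι → ℝ) (f f' : ι → ι → ℝ) (hf : ∀ k l, f' k l = f' l k) :
    cov[fun ω => quadForm S d f (fun k => X k ω), fun ω => quadForm S d' f' (fun k => X k ω); P] =
      2 * (∑ k ∈ S, ∑ l ∈ S, v k * v l * (f k l * f' k l))
        - 2 * (∑ k ∈ S, v k ^ 2 * (f k k * f' k k))
        + ∑ k ∈ S, v k ^ 2 * (κ k + 2) * ((d k - f k k) * (d' k - f' k k)) := by
  classical
  simp only [quadForm_eq_sum, h.covariance_sum_mul_mul, Finset.mul_sum]
  rw [← Finset.sum_sub_distrib, ← Finset.sum_add_distrib, ← Finset.sum_add_distrib]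
  refine Finset.sum_congr rfl fun k hk => ?_
  have hkl : ∀ l ∈ S, v k * v l * ((if l = k then d k else 0) - f k l) *
      ((if l = k then d' k else 0) - f' k l + ((if k = l then d' l else 0) - f' l k)) =
      2 * (v k * v l * (f k l * f' k l)) + if l = k then 2 * v k ^ 2 *
        ((d k - f k k) * (d' k - f' k k) - f k k * f' k k) else 0 := by
    intro l _
    rw [hf l k]
    by_cases hlk : l = k
    · subst hlk; simp only [if_true]; ring
    · simp only [if_neg hlk, if_neg (Ne.symm hlk)]; ring
  rw [Finset.sum_congr rfl hkl, Finset.sum_add_distrib]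
  simp only [Finset.sum_ite_eq', hk, if_true]
  ring

end IndependentEffects

/-! ### Observation patterns and their transposes -/

namespace ObservationPattern

variable (O : ObservationPattern)

/-- The pattern with the roles of rows and columns exchanged. -/
def transpose : ObservationPattern where
  Z i j := O.Z j i
  zero_or_one i j := O.zero_or_one j i
  finite_observed := O.finite_observed.preimage Prod.swap_injective.injOn
  exists_observed := by
    obtain ⟨i, j, h⟩ := O.exists_observed
    exact ⟨j, i, h⟩

theorem mem_rows {i : ℕ} : i ∈ O.rows ↔ ∃ j, O.Z i j = 1 := by
  simp [rows]

theorem mem_cols {j : ℕ} : j ∈ O.cols ↔ ∃ i, O.Z i j = 1 := by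
  simp [cols]

theorem transpose_Z (i j : ℕ) : O.transpose.Z i j = O.Z j i := rfl

theorem transpose_rows : O.transpose.rows = O.cols := by
  ext i; rw [mem_rows, mem_cols]; rfl

theorem transpose_cols : O.transpose.cols = O.rows := by
  ext i; rw [mem_rows, mem_cols]; rfl

theorem transpose_rowCount (i : ℕ) : O.transpose.rowCount i = O.colCount i := by
  simp only [rowCount, colCount, transpose_cols, transpose_Z]

theorem transpose_colCount (i : ℕ) : O.transpose.colCount i = O.rowCount i := by
  simp only [rowCount, colCount, transpose_rows, transpose_Z]

theorem transpose_N : O.transpose.N = O.N := by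
  simp only [N, transpose_rows, transpose_cols, transpose_Z]
  exact Finset.sum_comm

theorem transpose_R : O.transpose.R = O.C := by
  simp only [R, C, transpose_rows]

theorem transpose_ZZt (i r : ℕ) : O.transpose.ZZt i r = O.ZtZ i r := by
  simp only [ZZt, ZtZ, transpose_cols, transpose_Z]

theorem transpose_rowT (i : ℕ) : O.transpose.rowT i = O.colT i := by
  simp only [rowT, colT, transpose_cols, transpose_Z, transpose_colCount]

theorem transpose_Ua {Ω : Type*} (Y : ℕ → ℕ → Ω → ℝ) :
    O.transpose.Ua (fun i j => Y j i) = O.Ub Y := by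
  ext ω
  simp only [Ua, Ub, transpose_rows, transpose_cols, transpose_Z, transpose_rowCount]

theorem transpose_Ue {Ω : Type*} (Y : ℕ → ℕ → Ω → ℝ) :
    O.transpose.Ue (fun i j => Y j i) = O.Ue Y := by
  ext ω
  simp only [Ue, transpose_rows, transpose_cols, transpose_Z]
  congr 1
  rw [Finset.sum_comm]
  exact Finset.sum_congr rfl fun i _ => Finset.sum_congr rfl fun j _ => Finset.sum_comm

theorem Z_mul_self (i j : ℕ) : O.Z i j * O.Z i j = O.Z i j := by
  rcases O.zero_or_one i j with h | h <;> simp [h]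

theorem Z_nonneg (i j : ℕ) : 0 ≤ O.Z i j := by
  rcases O.zero_or_one i j with h | h <;> simp [h]

theorem rowCount_ne_zero {i : ℕ} (hi : i ∈ O.rows) : O.rowCount i ≠ 0 := by
  obtain ⟨j, hj⟩ := O.mem_rows.1 hi
  have hle : O.Z i j ≤ O.rowCount i :=
    Finset.single_le_sum (f := fun j => O.Z i j) (fun j _ => O.Z_nonneg i j)
      (O.mem_cols.2 ⟨i, hj⟩)
  rw [hj] at hle
  exact (zero_lt_one.trans_le hle).ne'

theorem sum_rowCount : ∑ i ∈ O.rows, O.rowCount i = O.N := rfl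

theorem sum_colCount : ∑ j ∈ O.cols, O.colCount j = O.N := Finset.sum_comm

theorem sum_Z_mul_row (g : ℕ → ℝ) :
    ∑ i ∈ O.rows, ∑ j ∈ O.cols, O.Z i j * g i = ∑ i ∈ O.rows, O.rowCount i * g i := by
  simp only [rowCount, Finset.sum_mul]

theorem sum_Z_mul_col (g : ℕ → ℝ) :
    ∑ i ∈ O.rows, ∑ j ∈ O.cols, O.Z i j * g j = ∑ j ∈ O.cols, O.colCount j * g j := by
  rw [Finset.sum_comm]
  simp only [colCount, Finset.sum_mul]

/-! ### The statistics as quadratic forms in the effects -/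

/-- The indices of the effects and errors that occur in the statistics: those of the rows and
columns with data and of all the cells in which they meet, observed or not. -/
noncomputable def effectIndices : Finset (ℕ ⊕ ℕ ⊕ ℕ × ℕ) :=
  O.rows.disjSum (O.cols.disjSum (O.rows ×ˢ O.cols))

theorem sum_effectIndices (g : ℕ ⊕ ℕ ⊕ ℕ × ℕ → ℝ) :
    ∑ k ∈ O.effectIndices, g k = ∑ i ∈ O.rows, g (.inl i) + (∑ j ∈ O.cols, g (.inr (.inl j))
      + ∑ i ∈ O.rows, ∑ j ∈ O.cols, g (.inr (.inr (i, j)))) := by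
  simp only [effectIndices, Finset.sum_disjSum, Finset.sum_product]

/-- The coefficients `d` in the representation of the within-row statistic as a `quadForm`: they
come from the sum of all `Z i j * Y i j ^ 2`, from which the row effects are omitted because they
cancel in the statistic. -/
noncomputable def rowDiag : ℕ ⊕ ℕ ⊕ ℕ × ℕ → ℝ
  | .inl _ => 0
  | .inr (.inl j) => O.colCount j
  | .inr (.inr p) => O.Z p.1 p.2

/-- The coefficients `f` in the representation of the within-row statistic as a `quadForm`: they
come from the squared row sums, weighted by the inverse row counts. The coefficients of a column
effect and an error also contain the cross term of the sum of squares. -/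
noncomputable def rowCoeff : ℕ ⊕ ℕ ⊕ ℕ × ℕ → ℕ ⊕ ℕ ⊕ ℕ × ℕ → ℝ
  | .inr (.inl j), .inr (.inl s) => ∑ i ∈ O.rows, (O.rowCount i)⁻¹ * O.Z i j * O.Z i s
  | .inr (.inl s), .inr (.inr p) =>
      (O.rowCount p.1)⁻¹ * O.Z p.1 s * O.Z p.1 p.2 - if p.2 = s then O.Z p.1 p.2 else 0
  | .inr (.inr p), .inr (.inl s) =>
      (O.rowCount p.1)⁻¹ * O.Z p.1 s * O.Z p.1 p.2 - if p.2 = s then O.Z p.1 p.2 else 0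
  | .inr (.inr p), .inr (.inr q) =>
      if q.1 = p.1 then (O.rowCount p.1)⁻¹ * O.Z p.1 p.2 * O.Z p.1 q.2 else 0
  | _, _ => 0

theorem rowCoeff_symm (k l : ℕ ⊕ ℕ ⊕ ℕ × ℕ) : O.rowCoeff k l = O.rowCoeff l k := by
  rcases k with i | j | ⟨i, j⟩ <;> rcases l with r | s | ⟨r, s⟩ <;> simp only [rowCoeff]
  · exact Finset.sum_congr rfl fun i _ => by ring
  · by_cases h : r = i
    · subst h; simp only [if_true]; ring
    · simp only [if_neg h, if_neg (Ne.symm h)]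

/-- Exchange of row and column effects. -/
def swapEffects : ℕ ⊕ ℕ ⊕ ℕ × ℕ → ℕ ⊕ ℕ ⊕ ℕ × ℕ
  | .inl i => .inr (.inl i)
  | .inr (.inl j) => .inl j
  | .inr (.inr p) => .inr (.inr p.swap)

/-- The number of observations that an effect enters. -/
noncomputable def effectCount : ℕ ⊕ ℕ ⊕ ℕ × ℕ → ℝ
  | .inl i => O.rowCount i
  | .inr (.inl j) => O.colCount j
  | .inr (.inr p) => O.Z p.1 p.2

/-- The number of observations that two effects of different kinds enter together, and `0` for two
effects of the same kind; in particular it is `0` on the diagonal. -/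
noncomputable def jointCount : ℕ ⊕ ℕ ⊕ ℕ × ℕ → ℕ ⊕ ℕ ⊕ ℕ × ℕ → ℝ
  | .inl i, .inr (.inl j) => O.Z i j
  | .inr (.inl j), .inl i => O.Z i j
  | .inl i, .inr (.inr p) => if p.1 = i then O.Z p.1 p.2 else 0
  | .inr (.inr p), .inl i => if p.1 = i then O.Z p.1 p.2 else 0
  | .inr (.inl j), .inr (.inr p) => if p.2 = j then O.Z p.1 p.2 else 0
  | .inr (.inr p), .inr (.inl j) => if p.2 = j then O.Z p.1 p.2 else 0
  | _, _ => 0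

/-- The coefficients `d` in the representation of the overall statistic as a `quadForm`, from
`N` times the sum of all `Z i j * Y i j ^ 2`. -/
noncomputable def overallDiag (k : ℕ ⊕ ℕ ⊕ ℕ × ℕ) : ℝ := O.N * O.effectCount k

/-- The coefficients `f` in the representation of the overall statistic as a `quadForm`, from the
square of the sum of all observations and from the cross terms of the sum of squares. -/
noncomputable def overallCoeff (k l : ℕ ⊕ ℕ ⊕ ℕ × ℕ) : ℝ :=
  O.effectCount k * O.effectCount l - O.N * O.jointCount k l

theorem overallCoeff_symm (k l : ℕ ⊕ ℕ ⊕ ℕ × ℕ) : O.overallCoeff k l = O.overallCoeff l k := by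
  rcases k with i | j | ⟨i, j⟩ <;> rcases l with r | s | ⟨r, s⟩ <;>
    simp only [overallCoeff, jointCount] <;> ring

/-- The effects of the model, as one family indexed by row effects, column effects and errors. -/
abbrev allEffects {α : Type*} (a b : ℕ → α) (e : ℕ → ℕ → α) : ℕ ⊕ ℕ ⊕ ℕ × ℕ → α :=
  Sum.elim a (Sum.elim b (fun p : ℕ × ℕ => e p.1 p.2))

/-- The weighted form of Lagrange's identity. -/
theorem half_sum_sq_sub {ι : Type*} (T : Finset ι) (w y : ι → ℝ) :
    (1 / 2) * ∑ p ∈ T, ∑ q ∈ T, w p * w q * (y p - y q) ^ 2 =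
      (∑ p ∈ T, w p) * (∑ p ∈ T, w p * y p ^ 2) - (∑ p ∈ T, w p * y p) ^ 2 := by
  have h : ∑ p ∈ T, ∑ q ∈ T, w p * w q * (y p - y q) ^ 2 =
      (∑ p ∈ T, w p * y p ^ 2) * (∑ p ∈ T, w p) + (∑ p ∈ T, w p) * (∑ p ∈ T, w p * y p ^ 2)
        - 2 * ((∑ p ∈ T, w p * y p) * (∑ p ∈ T, w p * y p)) := by
    simp only [Finset.sum_mul_sum]
    simp only [Finset.mul_sum]
    simp only [← Finset.sum_add_distrib, ← Finset.sum_sub_distrib]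
    exact Finset.sum_congr rfl fun p _ => Finset.sum_congr rfl fun q _ => by ring
  rw [h]; ring

/-- The within-row statistic as a quadratic form in the effects. -/
theorem Ua_eq_quadForm {Ω : Type*} {Y : ℕ → ℕ → Ω → ℝ} {m : ℝ} {a b : ℕ → Ω → ℝ}
    {e : ℕ → ℕ → Ω → ℝ} (hY : ∀ i j ω, Y i j ω = m + a i ω + b j ω + e i j ω) :
    O.Ua Y = fun ω =>
      quadForm O.effectIndices O.rowDiag O.rowCoeff (fun k => allEffects a b e k ω) := by
  ext ω
  have h1 : O.Ua Y ω = ∑ i ∈ O.rows, ((∑ j ∈ O.cols, O.Z i j * (b j ω + e i j ω) ^ 2)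
      - (O.rowCount i)⁻¹ * (∑ j ∈ O.cols, O.Z i j * (b j ω + e i j ω)) ^ 2) := by
    rw [Ua, Finset.mul_sum]
    refine Finset.sum_congr rfl fun i hi => ?_
    have h := half_sum_sq_sub O.cols (O.Z i) (fun j => b j ω + e i j ω)
    rw [show ∑ j ∈ O.cols, O.Z i j = O.rowCount i from rfl] at h
    calc _ = (O.rowCount i)⁻¹ * ((1 / 2) * ∑ p ∈ O.cols, ∑ q ∈ O.cols,
          O.Z i p * O.Z i q * (b p ω + e i p ω - (b q ω + e i q ω)) ^ 2) := by
          simp only [Finset.mul_sum, hY]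
          exact Finset.sum_congr rfl fun p _ => Finset.sum_congr rfl fun q _ => by ring
      _ = _ := by
          rw [h, mul_sub, inv_mul_cancel_left₀ (O.rowCount_ne_zero hi)]
  have hBB : ∑ j ∈ O.cols, ∑ s ∈ O.cols,
      (∑ i ∈ O.rows, (O.rowCount i)⁻¹ * O.Z i j * O.Z i s) * (b j ω * b s ω) =
      ∑ i ∈ O.rows, (O.rowCount i)⁻¹ * (∑ j ∈ O.cols, O.Z i j * b j ω) ^ 2 := by
    simp only [pow_two, Finset.mul_sum, Finset.sum_mul]
    rw [Finset.sum_comm' (s := O.rows) (t := fun _ => O.cols) (s' := fun _ => O.rows)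
      (t' := O.cols) (by simp [and_comm])]
    refine Finset.sum_congr rfl fun j _ => ?_
    rw [Finset.sum_comm]
    exact Finset.sum_congr rfl fun i _ => Finset.sum_congr rfl fun s _ => by ring
  have hBE : ∀ i ∈ O.rows, ∑ s ∈ O.cols, ∑ j ∈ O.cols,
      ((O.rowCount i)⁻¹ * O.Z i s * O.Z i j - if j = s then O.Z i j else 0) * (b s ω * e i j ω) =
      (O.rowCount i)⁻¹ * ((∑ j ∈ O.cols, O.Z i j * b j ω) * (∑ j ∈ O.cols, O.Z i j * e i j ω))
        - ∑ j ∈ O.cols, O.Z i j * (b j ω * e i j ω) := by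
    intro i _
    simp only [sub_mul, Finset.sum_sub_distrib, Finset.sum_mul_sum]
    simp only [Finset.mul_sum]
    congr 1
    · exact Finset.sum_congr rfl fun p _ => Finset.sum_congr rfl fun q _ => by ring
    · refine Finset.sum_congr rfl fun s hs => ?_
      simp [ite_mul, hs]
  have hEE : ∀ i ∈ O.rows, ∑ j ∈ O.cols, ∑ r ∈ O.rows, ∑ s ∈ O.cols,
      (if r = i then (O.rowCount i)⁻¹ * O.Z i j * O.Z i s else 0) * (e i j ω * e r s ω) =
      (O.rowCount i)⁻¹ * (∑ j ∈ O.cols, O.Z i j * e i j ω) ^ 2 := by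
    intro i hi
    simp only [pow_two, Finset.sum_mul_sum, ite_mul, zero_mul,
      Finset.sum_ite_irrel, Finset.sum_const_zero, Finset.sum_ite_eq', hi, if_true]
    simp only [Finset.mul_sum]
    exact Finset.sum_congr rfl fun p _ => Finset.sum_congr rfl fun q _ => by ring
  rw [h1]
  simp only [quadForm, sum_effectIndices, rowDiag, rowCoeff, Sum.elim_inl, Sum.elim_inr,
    zero_mul, Finset.sum_const_zero, zero_add, Finset.sum_add_distrib, hBB]
  rw [Finset.sum_comm (s := O.cols) (t := O.rows), Finset.sum_congr rfl hEE,
    Finset.sum_congr rfl hBE]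
  have hEB : ∑ i ∈ O.rows, ∑ j ∈ O.cols, ∑ s ∈ O.cols,
      ((O.rowCount i)⁻¹ * O.Z i s * O.Z i j - if j = s then O.Z i j else 0) * (e i j ω * b s ω) =
      ∑ i ∈ O.rows, ((O.rowCount i)⁻¹ *
        ((∑ j ∈ O.cols, O.Z i j * b j ω) * (∑ j ∈ O.cols, O.Z i j * e i j ω))
        - ∑ j ∈ O.cols, O.Z i j * (b j ω * e i j ω)) := by
    refine Finset.sum_congr rfl fun i hi => ?_
    rw [← hBE i hi, Finset.sum_comm]
    exact Finset.sum_congr rfl fun p _ => Finset.sum_congr rfl fun q _ => by ring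
  rw [hEB, ← O.sum_Z_mul_col fun j => b j ω ^ 2]
  simp only [← Finset.sum_add_distrib, ← Finset.sum_sub_distrib]
  refine Finset.sum_congr rfl fun i _ => ?_
  have hsq : ∑ j ∈ O.cols, O.Z i j * (b j ω + e i j ω) ^ 2 =
      ∑ j ∈ O.cols, O.Z i j * b j ω ^ 2 + ∑ j ∈ O.cols, O.Z i j * e i j ω ^ 2
        + 2 * ∑ j ∈ O.cols, O.Z i j * (b j ω * e i j ω) := by
    simp only [Finset.mul_sum, ← Finset.sum_add_distrib]
    exact Finset.sum_congr rfl fun j _ => by ring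
  simp only [hsq, mul_add, Finset.sum_add_distrib]
  ring

/-- The overall statistic as a quadratic form in the effects. -/
theorem Ue_eq_quadForm {Ω : Type*} {Y : ℕ → ℕ → Ω → ℝ} {m : ℝ} {a b : ℕ → Ω → ℝ}
    {e : ℕ → ℕ → Ω → ℝ} (hY : ∀ i j ω, Y i j ω = m + a i ω + b j ω + e i j ω) :
    O.Ue Y = fun ω =>
      quadForm O.effectIndices O.overallDiag O.overallCoeff (fun k => allEffects a b e k ω) := by
  ext ω
  have h1 : O.Ue Y ω = O.N * (∑ i ∈ O.rows, ∑ j ∈ O.cols, O.Z i j * (a i ω + b j ω + e i j ω) ^ 2)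
      - (∑ i ∈ O.rows, ∑ j ∈ O.cols, O.Z i j * (a i ω + b j ω + e i j ω)) ^ 2 := by
    have h := half_sum_sq_sub (O.rows ×ˢ O.cols) (fun p => O.Z p.1 p.2)
      (fun p => a p.1 ω + b p.2 ω + e p.1 p.2 ω)
    simp only [Finset.sum_product] at h
    rw [N, ← h, Ue]
    congr 1
    refine Finset.sum_congr rfl fun i _ => Finset.sum_congr rfl fun j _ =>
      Finset.sum_congr rfl fun r _ => Finset.sum_congr rfl fun s _ => ?_
    rw [hY, hY]; ring
  have hlin : ∑ i ∈ O.rows, ∑ j ∈ O.cols, O.Z i j * (a i ω + b j ω + e i j ω) =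
      ∑ k ∈ O.effectIndices, O.effectCount k * allEffects a b e k ω := by
    simp only [sum_effectIndices, effectCount, Sum.elim_inl, Sum.elim_inr, mul_add,
      Finset.sum_add_distrib, sum_Z_mul_row, sum_Z_mul_col, add_assoc]
  have hsq : ∑ i ∈ O.rows, ∑ j ∈ O.cols, O.Z i j * (a i ω + b j ω + e i j ω) ^ 2 =
      ∑ k ∈ O.effectIndices, O.effectCount k * allEffects a b e k ω ^ 2
        + ∑ k ∈ O.effectIndices, ∑ l ∈ O.effectIndices,
          O.jointCount k l * (allEffects a b e k ω * allEffects a b e l ω) := by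
    have hAE : ∀ i ∈ O.rows, ∑ r ∈ O.rows, ∑ s ∈ O.cols,
        (if r = i then O.Z r s else 0) * (a i ω * e r s ω) =
        ∑ s ∈ O.cols, O.Z i s * (a i ω * e i s ω) := by
      intro i hi
      simp only [ite_mul, zero_mul, Finset.sum_ite_irrel, Finset.sum_const_zero,
        Finset.sum_ite_eq', hi, if_true]
    have hEA : ∀ i ∈ O.rows, ∀ j ∈ O.cols, ∑ r ∈ O.rows,
        (if i = r then O.Z i j else 0) * (e i j ω * a r ω) = O.Z i j * (a i ω * e i j ω) := by
      intro i hi j _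
      simp only [ite_mul, zero_mul, Finset.sum_ite_eq, hi, if_true]
      ring
    have hBE : ∀ j ∈ O.cols, ∑ r ∈ O.rows, ∑ s ∈ O.cols,
        (if s = j then O.Z r s else 0) * (b j ω * e r s ω) =
        ∑ r ∈ O.rows, O.Z r j * (b j ω * e r j ω) := by
      intro i hi
      simp only [ite_mul, zero_mul, Finset.sum_ite_eq', hi, if_true]
    have hEB : ∀ i ∈ O.rows, ∀ j ∈ O.cols, ∑ s ∈ O.cols,
        (if j = s then O.Z i j else 0) * (e i j ω * b s ω) = O.Z i j * (b j ω * e i j ω) := by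
      intro i _ j hj
      simp only [ite_mul, zero_mul, Finset.sum_ite_eq, hj, if_true]
      ring
    have hE : ∀ i ∈ O.rows, ∀ j ∈ O.cols, (∑ r ∈ O.rows,
        (if i = r then O.Z i j else 0) * (e i j ω * a r ω)) + ∑ s ∈ O.cols,
        (if j = s then O.Z i j else 0) * (e i j ω * b s ω) =
        O.Z i j * (a i ω * e i j ω) + O.Z i j * (b j ω * e i j ω) := fun i hi j hj => by
      rw [hEA i hi j hj, hEB i hi j hj]
    simp only [sum_effectIndices, effectCount, jointCount, Sum.elim_inl, Sum.elim_inr,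
      zero_mul, Finset.sum_const_zero, zero_add, add_zero]
    rw [Finset.sum_congr rfl fun i hi => Finset.sum_congr rfl (hE i hi)]
    simp only [Finset.sum_add_distrib]
    rw [Finset.sum_congr rfl hAE, Finset.sum_congr rfl hBE,
      Finset.sum_comm (s := O.cols) (t := O.rows), Finset.sum_comm (s := O.cols) (t := O.rows),
      ← O.sum_Z_mul_row fun i => a i ω ^ 2, ← O.sum_Z_mul_col fun j => b j ω ^ 2]
    simp only [← Finset.sum_add_distrib]
    exact Finset.sum_congr rfl fun i _ => Finset.sum_congr rfl fun j _ => by ring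
  have hcross : ∑ k ∈ O.effectIndices, ∑ l ∈ O.effectIndices,
      O.overallCoeff k l * (allEffects a b e k ω * allEffects a b e l ω) =
      (∑ k ∈ O.effectIndices, O.effectCount k * allEffects a b e k ω) ^ 2
        - O.N * ∑ k ∈ O.effectIndices, ∑ l ∈ O.effectIndices,
          O.jointCount k l * (allEffects a b e k ω * allEffects a b e l ω) := by
    rw [pow_two, Finset.sum_mul_sum]
    simp only [Finset.mul_sum, ← Finset.sum_sub_distrib, overallCoeff]
    exact Finset.sum_congr rfl fun k _ => Finset.sum_congr rfl fun l _ => by ring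
  rw [h1, hlin, hsq, quadForm, hcross]
  simp only [overallDiag, mul_assoc, ← Finset.mul_sum]
  ring

end ObservationPattern

/-! ### The crossed random effects model -/

namespace IdenticalEffects

variable {Ω : Type*} [MeasurableSpace Ω] {P : Measure Ω}

theorem memLp_four {ι : Type*} {X : ι → Ω → ℝ} {v κ : ℝ}
    (h : IdenticalEffects P X v κ) (k : ι) : MemLp (X k) 4 P := by
  rw [← integrable_norm_rpow_iff (h.measurable k).aestronglyMeasurable (by simp) (by simp)]
  refine (h.integrable_fourth k).congr (Filter.Eventually.of_forall fun ω => ?_)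
  have h4 : (4 : ENNReal).toReal = ((4 : ℕ) : ℝ) := by simp
  simp only [h4, Real.rpow_natCast, Real.norm_eq_abs]
  exact ((by decide : Even 4).pow_abs _).symm

theorem sq_moment_eq {ι : Type*} {X : ι → Ω → ℝ} {v κ : ℝ}
    (h : IdenticalEffects P X v κ) (k : ι) : ∫ ω, X k ω ^ 2 ∂P = v := by
  rw [← h.variance_eq k, variance_of_integral_eq_zero (h.measurable k).aemeasurable (h.mean_eq k)]

end IdenticalEffects

namespace CrossedRandomEffects

variable {Ω : Type*} [MeasurableSpace Ω] {P : Measure Ω}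
  {Y : ℕ → ℕ → Ω → ℝ} {m : ℝ} {a b : ℕ → Ω → ℝ} {e : ℕ → ℕ → Ω → ℝ}
  {vA vB vE κA κB κE : ℝ}

theorem independentEffects (hY : CrossedRandomEffects P Y m a b e vA vB vE κA κB κE) :
    IndependentEffects P (ObservationPattern.allEffects a b e)
      (ObservationPattern.allEffects (fun _ => vA) (fun _ => vB) (fun _ _ => vE))
      (ObservationPattern.allEffects (fun _ => κA) (fun _ => κB) (fun _ _ => κE)) where
  indep := hY.indep
  measurable := by
    rintro (i | j | p)
    exacts [hY.row_effects.measurable i, hY.col_effects.measurable j, hY.errors.measurable p]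
  memLp_four := by
    rintro (i | j | p)
    exacts [hY.row_effects.memLp_four i, hY.col_effects.memLp_four j, hY.errors.memLp_four p]
  mean_eq := by
    rintro (i | j | p)
    exacts [hY.row_effects.mean_eq i, hY.col_effects.mean_eq j, hY.errors.mean_eq p]
  sq_moment_eq := by
    rintro (i | j | p)
    exacts [hY.row_effects.sq_moment_eq i, hY.col_effects.sq_moment_eq j, hY.errors.sq_moment_eq p]
  fourth_moment_eq := by
    rintro (i | j | p)
    exacts [hY.row_effects.fourth_moment_eq i, hY.col_effects.fourth_moment_eq j,
      hY.errors.fourth_moment_eq p]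

/-- Exchanging rows and columns turns the model into a model of the same kind. -/
theorem transpose (hY : CrossedRandomEffects P Y m a b e vA vB vE κA κB κE) :
    CrossedRandomEffects P (fun i j => Y j i) m b a (fun i j => e j i) vB vA vE κB κA κE where
  response_eq i j ω := by rw [hY.response_eq]; ring
  indep := by
    have hinj : Function.Injective ObservationPattern.swapEffects := by
      rintro (i | j | ⟨i, j⟩) (r | s | ⟨r, s⟩) <;>
        simp [ObservationPattern.swapEffects, and_comm]
    convert hY.indep.precomp hinj using 2 with k
    rcases k with i | j | p <;> rfl
  row_effects := hY.col_effects
  col_effects := hY.row_effects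
  errors :=
    { measurable := fun p => hY.errors.measurable p.swap
      identDistrib := fun p q => hY.errors.identDistrib p.swap q.swap
      mean_eq := fun p => hY.errors.mean_eq p.swap
      variance_eq := fun p => hY.errors.variance_eq p.swap
      integrable_fourth := fun p => hY.errors.integrable_fourth p.swap
      fourth_moment_eq := fun p => hY.errors.fourth_moment_eq p.swap }

/-- The covariance of two quadratic forms in the effects of the model, split according to the kinds
of effects that are multiplied. -/
theorem covariance_quadForm [IsProbabilityMeasure P]
    (hY : CrossedRandomEffects P Y m a b e vA vB vE κA κB κE) (O : ObservationPattern)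
    {d d' : ℕ ⊕ ℕ ⊕ ℕ × ℕ → ℝ} {f f' : ℕ ⊕ ℕ ⊕ ℕ × ℕ → ℕ ⊕ ℕ ⊕ ℕ × ℕ → ℝ}
    (hf : ∀ k l, f k l = f l k) (hf' : ∀ k l, f' k l = f' l k) :
    cov[fun ω => quadForm O.effectIndices d f (fun k => ObservationPattern.allEffects a b e k ω),
      fun ω => quadForm O.effectIndices d' f'
        (fun k => ObservationPattern.allEffects a b e k ω); P] =
      2 * vA ^ 2 * ((∑ i ∈ O.rows, ∑ r ∈ O.rows, f (.inl i) (.inl r) * f' (.inl i) (.inl r))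
          - ∑ i ∈ O.rows, f (.inl i) (.inl i) * f' (.inl i) (.inl i))
        + vA ^ 2 * (κA + 2) * (∑ i ∈ O.rows,
          (d (.inl i) - f (.inl i) (.inl i)) * (d' (.inl i) - f' (.inl i) (.inl i)))
        + 2 * vB ^ 2 * ((∑ j ∈ O.cols, ∑ s ∈ O.cols,
            f (.inr (.inl j)) (.inr (.inl s)) * f' (.inr (.inl j)) (.inr (.inl s)))
          - ∑ j ∈ O.cols, f (.inr (.inl j)) (.inr (.inl j)) * f' (.inr (.inl j)) (.inr (.inl j)))
        + vB ^ 2 * (κB + 2) * (∑ j ∈ O.cols,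
          (d (.inr (.inl j)) - f (.inr (.inl j)) (.inr (.inl j)))
            * (d' (.inr (.inl j)) - f' (.inr (.inl j)) (.inr (.inl j))))
        + 2 * vE ^ 2 * ((∑ i ∈ O.rows, ∑ j ∈ O.cols, ∑ r ∈ O.rows, ∑ s ∈ O.cols,
            f (.inr (.inr (i, j))) (.inr (.inr (r, s)))
              * f' (.inr (.inr (i, j))) (.inr (.inr (r, s))))
          - ∑ i ∈ O.rows, ∑ j ∈ O.cols, f (.inr (.inr (i, j))) (.inr (.inr (i, j)))
              * f' (.inr (.inr (i, j))) (.inr (.inr (i, j))))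
        + vE ^ 2 * (κE + 2) * (∑ i ∈ O.rows, ∑ j ∈ O.cols,
          (d (.inr (.inr (i, j))) - f (.inr (.inr (i, j))) (.inr (.inr (i, j))))
            * (d' (.inr (.inr (i, j))) - f' (.inr (.inr (i, j))) (.inr (.inr (i, j)))))
        + 4 * vA * vB * (∑ i ∈ O.rows, ∑ j ∈ O.cols,
          f (.inl i) (.inr (.inl j)) * f' (.inl i) (.inr (.inl j)))
        + 4 * vA * vE * (∑ r ∈ O.rows, ∑ i ∈ O.rows, ∑ j ∈ O.cols,
          f (.inl r) (.inr (.inr (i, j))) * f' (.inl r) (.inr (.inr (i, j))))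
        + 4 * vB * vE * (∑ s ∈ O.cols, ∑ i ∈ O.rows, ∑ j ∈ O.cols,
          f (.inr (.inl s)) (.inr (.inr (i, j))) * f' (.inr (.inl s)) (.inr (.inr (i, j)))) := by
  have hBA : ∑ j ∈ O.cols, ∑ i ∈ O.rows, f (.inr (.inl j)) (.inl i) * f' (.inr (.inl j)) (.inl i) =
      ∑ i ∈ O.rows, ∑ j ∈ O.cols, f (.inl i) (.inr (.inl j)) * f' (.inl i) (.inr (.inl j)) := by
    rw [Finset.sum_comm]
    simp only [hf (.inr _) (.inl _), hf' (.inr _) (.inl _)]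
  have hEA : ∑ i ∈ O.rows, ∑ j ∈ O.cols, ∑ r ∈ O.rows,
      f (.inr (.inr (i, j))) (.inl r) * f' (.inr (.inr (i, j))) (.inl r) =
      ∑ r ∈ O.rows, ∑ i ∈ O.rows, ∑ j ∈ O.cols,
        f (.inl r) (.inr (.inr (i, j))) * f' (.inl r) (.inr (.inr (i, j))) := by
    rw [Finset.sum_comm (s := O.rows) (t := O.rows)]
    simp only [hf (.inr _) (.inl _), hf' (.inr _) (.inl _)]
    exact Finset.sum_congr rfl fun i _ => Finset.sum_comm
  have hEB : ∑ i ∈ O.rows, ∑ j ∈ O.cols, ∑ s ∈ O.cols,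
      f (.inr (.inr (i, j))) (.inr (.inl s)) * f' (.inr (.inr (i, j))) (.inr (.inl s)) =
      ∑ s ∈ O.cols, ∑ i ∈ O.rows, ∑ j ∈ O.cols,
        f (.inr (.inl s)) (.inr (.inr (i, j))) * f' (.inr (.inl s)) (.inr (.inr (i, j))) := by
    rw [Finset.sum_comm (s := O.cols) (t := O.rows)]
    simp only [hf (.inr (.inr _)) (.inr (.inl _)), hf' (.inr (.inr _)) (.inr (.inl _))]
    exact Finset.sum_congr rfl fun i _ => Finset.sum_comm
  rw [hY.independentEffects.covariance_quadForm _ _ _ _ _ hf']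
  simp only [O.sum_effectIndices, ObservationPattern.allEffects, Sum.elim_inl, Sum.elim_inr,
    Finset.sum_add_distrib, ← Finset.mul_sum, hBA, hEA, hEB]
  ring

end CrossedRandomEffects

/-! ### Sums of coefficients -/

namespace ObservationPattern

variable (O : ObservationPattern)

theorem sum_inv_mul_rowCount : ∑ i ∈ O.rows, (O.rowCount i)⁻¹ * O.rowCount i = O.R := by
  rw [Finset.sum_congr rfl fun i hi => inv_mul_cancel₀ (O.rowCount_ne_zero hi)]
  simp [R]

theorem sum_one_sub_inv_mul_rowCount :
    ∑ i ∈ O.rows, O.rowCount i * (1 - (O.rowCount i)⁻¹) = O.N - O.R := by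
  rw [← O.sum_inv_mul_rowCount, ← O.sum_rowCount, ← Finset.sum_sub_distrib]
  exact Finset.sum_congr rfl fun i _ => by ring

theorem rowCoeff_col_self (j : ℕ) :
    O.rowCoeff (.inr (.inl j)) (.inr (.inl j)) = ∑ i ∈ O.rows, (O.rowCount i)⁻¹ * O.Z i j := by
  simp only [rowCoeff, mul_assoc, Z_mul_self]

theorem rowCoeff_error_self (i j : ℕ) :
    O.rowCoeff (.inr (.inr (i, j))) (.inr (.inr (i, j))) = (O.rowCount i)⁻¹ * O.Z i j := by
  simp only [rowCoeff, mul_assoc, Z_mul_self, if_true]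

theorem rowDiag_sub_rowCoeff_col (j : ℕ) :
    O.rowDiag (.inr (.inl j)) - O.rowCoeff (.inr (.inl j)) (.inr (.inl j)) =
      ∑ i ∈ O.rows, O.Z i j * (1 - (O.rowCount i)⁻¹) := by
  rw [rowCoeff_col_self, rowDiag, colCount, ← Finset.sum_sub_distrib]
  exact Finset.sum_congr rfl fun i _ => by ring

theorem rowDiag_sub_rowCoeff_error (i j : ℕ) :
    O.rowDiag (.inr (.inr (i, j))) - O.rowCoeff (.inr (.inr (i, j))) (.inr (.inr (i, j))) =
      O.Z i j * (1 - (O.rowCount i)⁻¹) := by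
  rw [rowCoeff_error_self, rowDiag]
  ring

theorem sum_rowCoeff_col_mul (h : ℕ → ℕ → ℝ) :
    ∑ j ∈ O.cols, ∑ s ∈ O.cols, O.rowCoeff (.inr (.inl j)) (.inr (.inl s)) * h j s =
      ∑ i ∈ O.rows, (O.rowCount i)⁻¹ * ∑ j ∈ O.cols, ∑ s ∈ O.cols,
        O.Z i j * O.Z i s * h j s := by
  simp only [rowCoeff, Finset.sum_mul, Finset.mul_sum]
  rw [Finset.sum_comm (s := O.rows)]
  refine Finset.sum_congr rfl fun j _ => ?_
  rw [Finset.sum_comm]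
  exact Finset.sum_congr rfl fun i _ => Finset.sum_congr rfl fun s _ => by ring

theorem sum_rowCoeff_col_error_mul (h : ℕ → ℕ → ℕ → ℝ) :
    ∑ s ∈ O.cols, ∑ i ∈ O.rows, ∑ j ∈ O.cols,
        O.rowCoeff (.inr (.inl s)) (.inr (.inr (i, j))) * h s i j =
      ∑ i ∈ O.rows, ((O.rowCount i)⁻¹ * (∑ s ∈ O.cols, ∑ j ∈ O.cols,
        O.Z i s * O.Z i j * h s i j) - ∑ j ∈ O.cols, O.Z i j * h j i j) := by
  rw [Finset.sum_comm]
  refine Finset.sum_congr rfl fun i _ => ?_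
  simp only [rowCoeff, sub_mul, Finset.sum_sub_distrib, Finset.mul_sum]
  congr 1
  · exact Finset.sum_congr rfl fun s _ => Finset.sum_congr rfl fun j _ => by ring
  · refine Finset.sum_congr rfl fun s hs => ?_
    simp [ite_mul, hs]

/-- Products of two errors occur in the within-row statistic only within a row. -/
theorem sum_rowCoeff_error_mul (h : ℕ → ℕ → ℕ → ℕ → ℝ) :
    ∑ i ∈ O.rows, ∑ j ∈ O.cols, ∑ r ∈ O.rows, ∑ s ∈ O.cols,
        O.rowCoeff (.inr (.inr (i, j))) (.inr (.inr (r, s))) * h i j r s =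
      ∑ i ∈ O.rows, (O.rowCount i)⁻¹ * ∑ j ∈ O.cols, ∑ s ∈ O.cols,
        O.Z i j * O.Z i s * h i j i s := by
  refine Finset.sum_congr rfl fun i hi => ?_
  rw [Finset.mul_sum]
  refine Finset.sum_congr rfl fun j _ => ?_
  simp only [rowCoeff, ite_mul, zero_mul, Finset.sum_ite_irrel, Finset.sum_const_zero,
    Finset.sum_ite_eq', hi, if_true, Finset.mul_sum]
  exact Finset.sum_congr rfl fun s _ => by ring

/-- The within-column statistic as a quadratic form in the effects, by exchange of rows and
columns. -/
theorem Ub_eq_quadForm {Ω : Type*} {Y : ℕ → ℕ → Ω → ℝ} {m : ℝ} {a b : ℕ → Ω → ℝ}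
    {e : ℕ → ℕ → Ω → ℝ} (hY : ∀ i j ω, Y i j ω = m + a i ω + b j ω + e i j ω) :
    O.Ub Y = fun ω => quadForm O.effectIndices (fun k => O.transpose.rowDiag (swapEffects k))
      (fun k l => O.transpose.rowCoeff (swapEffects k) (swapEffects l))
      (fun k => allEffects a b e k ω) := by
  have hsum : ∀ g : ℕ ⊕ ℕ ⊕ ℕ × ℕ → ℝ,
      ∑ k ∈ O.transpose.effectIndices, g k = ∑ k ∈ O.effectIndices, g (swapEffects k) := by
    intro g
    simp only [sum_effectIndices, transpose_rows, transpose_cols, swapEffects, Prod.swap]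
    rw [Finset.sum_comm (s := O.cols) (t := O.rows)]
    ring
  have heff : ∀ k ω, allEffects b a (fun i j => e j i) (swapEffects k) ω =
      allEffects a b e k ω := by
    rintro (i | j | p) ω <;> rfl
  rw [← transpose_Ua, O.transpose.Ua_eq_quadForm (m := m) (a := b) (b := a)
    (e := fun i j => e j i) (fun i j ω => by rw [hY]; ring)]
  ext ω
  simp only [quadForm, hsum, heff]

end ObservationPattern

/-! ### Variances and covariances of the statistics -/

namespace CrossedRandomEffects

variable {Ω : Type*} [MeasurableSpace Ω] {P : Measure Ω}
  {Y : ℕ → ℕ → Ω → ℝ} {m : ℝ} {a b : ℕ → Ω → ℝ} {e : ℕ → ℕ → Ω → ℝ}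
  {vA vB vE κA κB κE : ℝ}

theorem memLp_Ua (hY : CrossedRandomEffects P Y m a b e vA vB vE κA κB κE)
    (O : ObservationPattern) : MemLp (O.Ua Y) 2 P := by
  rw [O.Ua_eq_quadForm hY.response_eq]
  exact hY.independentEffects.memLp_quadForm _ _ _

theorem memLp_Ue (hY : CrossedRandomEffects P Y m a b e vA vB vE κA κB κE)
    (O : ObservationPattern) : MemLp (O.Ue Y) 2 P := by
  rw [O.Ue_eq_quadForm hY.response_eq]
  exact hY.independentEffects.memLp_quadForm _ _ _

variable [IsProbabilityMeasure P]

/-- The row effects cancel, so that only the column effects and the errors contribute. -/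
theorem variance_Ua (hY : CrossedRandomEffects P Y m a b e vA vB vE κA κB κE)
    (O : ObservationPattern) :
    Var[O.Ua Y; P] =
      vB ^ 2 * (κB + 2) * (∑ i ∈ O.rows, ∑ r ∈ O.rows,
          O.ZZt i r * (1 - (O.rowCount i)⁻¹) * (1 - (O.rowCount r)⁻¹))
        + 2 * vB ^ 2 * (∑ i ∈ O.rows, ∑ r ∈ O.rows,
          (O.rowCount i)⁻¹ * (O.rowCount r)⁻¹ * (O.ZZt i r * (O.ZZt i r - 1)))
        + 4 * vB * vE * (O.N - O.R)
        + vE ^ 2 * (κE + 2) * (∑ i ∈ O.rows, O.rowCount i * (1 - (O.rowCount i)⁻¹) ^ 2)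
        + 2 * vE ^ 2 * (∑ i ∈ O.rows, (1 - (O.rowCount i)⁻¹)) := by
  have hB : ∑ j ∈ O.cols, ∑ s ∈ O.cols, O.rowCoeff (.inr (.inl j)) (.inr (.inl s))
        * O.rowCoeff (.inr (.inl j)) (.inr (.inl s))
      - ∑ j ∈ O.cols, O.rowCoeff (.inr (.inl j)) (.inr (.inl j))
        * O.rowCoeff (.inr (.inl j)) (.inr (.inl j)) =
      ∑ i ∈ O.rows, ∑ r ∈ O.rows,
        (O.rowCount i)⁻¹ * (O.rowCount r)⁻¹ * (O.ZZt i r * (O.ZZt i r - 1)) := by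
    have h1 : ∑ j ∈ O.cols, O.rowCoeff (.inr (.inl j)) (.inr (.inl j))
        * O.rowCoeff (.inr (.inl j)) (.inr (.inl j)) =
        ∑ i ∈ O.rows, ∑ r ∈ O.rows, (O.rowCount i)⁻¹ * (O.rowCount r)⁻¹ * O.ZZt i r := by
      simp only [O.rowCoeff_col_self, Finset.sum_mul_sum, ObservationPattern.ZZt]
      simp only [Finset.mul_sum]
      rw [Finset.sum_comm]
      refine Finset.sum_congr rfl fun i _ => ?_
      rw [Finset.sum_comm]
      exact Finset.sum_congr rfl fun r _ => Finset.sum_congr rfl fun j _ => by ring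
    have h2 : ∀ i, ∑ j ∈ O.cols, ∑ s ∈ O.cols, O.Z i j * O.Z i s
        * O.rowCoeff (.inr (.inl j)) (.inr (.inl s)) =
        ∑ r ∈ O.rows, (O.rowCount r)⁻¹ * (O.ZZt i r * O.ZZt i r) := by
      intro i
      simp only [mul_comm (O.Z i _ * O.Z i _), O.sum_rowCoeff_col_mul, ObservationPattern.ZZt,
        Finset.sum_mul_sum]
      refine Finset.sum_congr rfl fun r _ => congrArg _ ?_
      exact Finset.sum_congr rfl fun j _ => Finset.sum_congr rfl fun s _ => by ring
    rw [h1, O.sum_rowCoeff_col_mul]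
    simp only [h2, Finset.mul_sum, ← Finset.sum_sub_distrib]
    exact Finset.sum_congr rfl fun i _ => Finset.sum_congr rfl fun r _ => by ring
  have hBκ : ∑ j ∈ O.cols, (∑ i ∈ O.rows, O.Z i j * (1 - (O.rowCount i)⁻¹))
      * (∑ i ∈ O.rows, O.Z i j * (1 - (O.rowCount i)⁻¹)) =
      ∑ i ∈ O.rows, ∑ r ∈ O.rows,
        O.ZZt i r * (1 - (O.rowCount i)⁻¹) * (1 - (O.rowCount r)⁻¹) := by
    simp only [Finset.sum_mul_sum, ObservationPattern.ZZt]
    simp only [Finset.sum_mul]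
    rw [Finset.sum_comm]
    refine Finset.sum_congr rfl fun i _ => ?_
    rw [Finset.sum_comm]
    exact Finset.sum_congr rfl fun r _ => Finset.sum_congr rfl fun j _ => by ring
  have hE : (∑ i ∈ O.rows, ∑ j ∈ O.cols, ∑ r ∈ O.rows, ∑ s ∈ O.cols,
        O.rowCoeff (.inr (.inr (i, j))) (.inr (.inr (r, s)))
          * O.rowCoeff (.inr (.inr (i, j))) (.inr (.inr (r, s))))
      - ∑ i ∈ O.rows, ∑ j ∈ O.cols, O.rowCoeff (.inr (.inr (i, j))) (.inr (.inr (i, j)))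
          * O.rowCoeff (.inr (.inr (i, j))) (.inr (.inr (i, j))) =
      ∑ i ∈ O.rows, (1 - (O.rowCount i)⁻¹) := by
    rw [O.sum_rowCoeff_error_mul, ← Finset.sum_sub_distrib]
    refine Finset.sum_congr rfl fun i hi => ?_
    have h1 : ∑ j ∈ O.cols, ∑ s ∈ O.cols, O.Z i j * O.Z i s
        * O.rowCoeff (.inr (.inr (i, j))) (.inr (.inr (i, s))) =
        (O.rowCount i)⁻¹ * (O.rowCount i * O.rowCount i) := by
      simp only [ObservationPattern.rowCoeff, if_true]
      generalize (O.rowCount i)⁻¹ = c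
      simp only [ObservationPattern.rowCount, Finset.sum_mul_sum]
      simp only [Finset.mul_sum]
      refine Finset.sum_congr rfl fun j _ => Finset.sum_congr rfl fun s _ => ?_
      linear_combination c * O.Z i s * O.Z i s * O.Z_mul_self i j + c * O.Z i j * O.Z_mul_self i s
    have h2 : ∑ j ∈ O.cols, O.rowCoeff (.inr (.inr (i, j))) (.inr (.inr (i, j)))
        * O.rowCoeff (.inr (.inr (i, j))) (.inr (.inr (i, j))) =
        (O.rowCount i)⁻¹ * ((O.rowCount i)⁻¹ * O.rowCount i) := by
      simp only [O.rowCoeff_error_self, ObservationPattern.rowCount, Finset.mul_sum]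
      refine Finset.sum_congr rfl fun j _ => ?_
      rw [mul_mul_mul_comm, O.Z_mul_self, mul_assoc]
    have h0 := O.rowCount_ne_zero hi
    rw [h1, h2]
    field_simp
  have hEκ : ∑ i ∈ O.rows, ∑ j ∈ O.cols, O.Z i j * (1 - (O.rowCount i)⁻¹)
      * (O.Z i j * (1 - (O.rowCount i)⁻¹)) =
      ∑ i ∈ O.rows, O.rowCount i * (1 - (O.rowCount i)⁻¹) ^ 2 := by
    rw [← O.sum_Z_mul_row]
    refine Finset.sum_congr rfl fun i _ => Finset.sum_congr rfl fun j _ => ?_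
    linear_combination (1 - (O.rowCount i)⁻¹) ^ 2 * O.Z_mul_self i j
  have hBE : ∑ s ∈ O.cols, ∑ i ∈ O.rows, ∑ j ∈ O.cols,
      O.rowCoeff (.inr (.inl s)) (.inr (.inr (i, j)))
        * O.rowCoeff (.inr (.inl s)) (.inr (.inr (i, j))) = O.N - O.R := by
    rw [O.sum_rowCoeff_col_error_mul, ← O.sum_inv_mul_rowCount, ← O.sum_rowCount,
      ← Finset.sum_sub_distrib]
    refine Finset.sum_congr rfl fun i hi => ?_
    have h0 := O.rowCount_ne_zero hi
    have h1 : ∑ j ∈ O.cols, O.Z i j * O.rowCoeff (.inr (.inl j)) (.inr (.inr (i, j))) =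
        (O.rowCount i)⁻¹ * O.rowCount i - O.rowCount i := by
      simp only [ObservationPattern.rowCoeff, if_true, ObservationPattern.rowCount, Finset.mul_sum,
        ← Finset.sum_sub_distrib]
      refine Finset.sum_congr rfl fun j _ => ?_
      rw [mul_sub, mul_assoc, O.Z_mul_self, mul_left_comm, O.Z_mul_self]
    have h2 : ∑ s ∈ O.cols, ∑ j ∈ O.cols, O.Z i s * O.Z i j
        * O.rowCoeff (.inr (.inl s)) (.inr (.inr (i, j))) =
        (O.rowCount i)⁻¹ * (O.rowCount i * O.rowCount i) - O.rowCount i := by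
      have h3 : ∑ s ∈ O.cols, ∑ j ∈ O.cols, O.Z i s * O.Z i j
          * (if j = s then O.Z i j else 0) = O.rowCount i := by
        refine Finset.sum_congr rfl fun s hs => ?_
        simp [hs, O.Z_mul_self]
      simp only [ObservationPattern.rowCoeff, mul_sub, Finset.sum_sub_distrib, h3]
      congr 1
      generalize (O.rowCount i)⁻¹ = c
      simp only [ObservationPattern.rowCount, Finset.sum_mul_sum]
      simp only [Finset.mul_sum]
      refine Finset.sum_congr rfl fun j _ => Finset.sum_congr rfl fun s _ => ?_
      linear_combination c * O.Z i s * O.Z i s * O.Z_mul_self i j + c * O.Z i j * O.Z_mul_self i s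
    rw [h1, h2]
    field_simp
    ring
  rw [← covariance_self (hY.memLp_Ua O).aestronglyMeasurable.aemeasurable,
    O.Ua_eq_quadForm hY.response_eq, hY.covariance_quadForm O O.rowCoeff_symm O.rowCoeff_symm, hB,
    hE, hBE]
  simp only [O.rowDiag_sub_rowCoeff_col, O.rowDiag_sub_rowCoeff_error, hBκ, hEκ]
  simp only [ObservationPattern.rowDiag, ObservationPattern.rowCoeff, mul_zero, sub_self,
    Finset.sum_const_zero, zero_add, add_zero]
  ring

/-- Only the squares of the errors contribute: the two statistics share neither row nor column
effects, and no product of two distinct errors occurs in both. -/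
theorem covariance_Ua_Ub (hY : CrossedRandomEffects P Y m a b e vA vB vE κA κB κE)
    (O : ObservationPattern) :
    cov[O.Ua Y, O.Ub Y; P] =
      vE ^ 2 * (κE + 2) * (∑ i ∈ O.rows, ∑ j ∈ O.cols,
        O.Z i j * (1 - (O.rowCount i)⁻¹) * (1 - (O.colCount j)⁻¹)) := by
  have hE : (∑ i ∈ O.rows, ∑ j ∈ O.cols, ∑ r ∈ O.rows, ∑ s ∈ O.cols,
        O.rowCoeff (.inr (.inr (i, j))) (.inr (.inr (r, s)))
          * O.transpose.rowCoeff (.inr (.inr (j, i))) (.inr (.inr (s, r))))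
      = ∑ i ∈ O.rows, ∑ j ∈ O.cols, O.rowCoeff (.inr (.inr (i, j))) (.inr (.inr (i, j)))
          * O.transpose.rowCoeff (.inr (.inr (j, i))) (.inr (.inr (j, i))) := by
    rw [O.sum_rowCoeff_error_mul]
    refine Finset.sum_congr rfl fun i hi => ?_
    rw [Finset.mul_sum]
    refine Finset.sum_congr rfl fun j hj => ?_
    simp only [ObservationPattern.rowCoeff, if_true, mul_ite, mul_zero, Finset.sum_ite_eq', hj]
    ring
  have hEκ : ∑ i ∈ O.rows, ∑ j ∈ O.cols, O.Z i j * (1 - (O.rowCount i)⁻¹)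
      * (O.Z i j * (1 - (O.colCount j)⁻¹)) =
      ∑ i ∈ O.rows, ∑ j ∈ O.cols,
        O.Z i j * (1 - (O.rowCount i)⁻¹) * (1 - (O.colCount j)⁻¹) := by
    refine Finset.sum_congr rfl fun i _ => Finset.sum_congr rfl fun j _ => ?_
    linear_combination (1 - (O.rowCount i)⁻¹) * (1 - (O.colCount j)⁻¹) * O.Z_mul_self i j
  rw [O.Ua_eq_quadForm hY.response_eq, O.Ub_eq_quadForm hY.response_eq,
    hY.covariance_quadForm O O.rowCoeff_symm (fun k l => O.transpose.rowCoeff_symm _ _)]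
  simp only [ObservationPattern.swapEffects, Prod.swap, hE, O.rowDiag_sub_rowCoeff_error,
    O.transpose.rowDiag_sub_rowCoeff_error, O.transpose_rowCount, O.transpose_Z, hEκ]
  simp only [ObservationPattern.rowDiag, ObservationPattern.rowCoeff, mul_zero, zero_mul, sub_self,
    Finset.sum_const_zero, zero_add, add_zero]

theorem covariance_Ua_Ue (hY : CrossedRandomEffects P Y m a b e vA vB vE κA κB κE)
    (O : ObservationPattern) :
    cov[O.Ua Y, O.Ue Y; P] =
      2 * vB ^ 2 * ((∑ i ∈ O.rows, (O.rowCount i)⁻¹ * O.rowT i ^ 2)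
          - ∑ i ∈ O.rows, ∑ j ∈ O.cols, O.Z i j * (O.rowCount i)⁻¹ * O.colCount j ^ 2)
        + vB ^ 2 * (κB + 2) * (∑ i ∈ O.rows, ∑ j ∈ O.cols,
          O.Z i j * (O.N - O.colCount j) * O.colCount j * (1 - (O.rowCount i)⁻¹))
        + 2 * vE ^ 2 * (O.N - O.R) + vE ^ 2 * (κE + 2) * (O.N - O.R) * (O.N - 1)
        + 4 * vB * vE * O.N * (O.N - O.R) := by
  have hN : ∀ i ∈ O.rows, ∑ j ∈ O.cols, O.Z i j = O.rowCount i := fun _ _ => rfl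
  have hB : ∑ j ∈ O.cols, ∑ s ∈ O.cols, O.rowCoeff (.inr (.inl j)) (.inr (.inl s))
        * O.overallCoeff (.inr (.inl j)) (.inr (.inl s))
      - ∑ j ∈ O.cols, O.rowCoeff (.inr (.inl j)) (.inr (.inl j))
        * O.overallCoeff (.inr (.inl j)) (.inr (.inl j)) =
      (∑ i ∈ O.rows, (O.rowCount i)⁻¹ * O.rowT i ^ 2)
        - ∑ i ∈ O.rows, ∑ j ∈ O.cols, O.Z i j * (O.rowCount i)⁻¹ * O.colCount j ^ 2 := by
    rw [O.sum_rowCoeff_col_mul]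
    simp only [O.rowCoeff_col_self, ObservationPattern.overallCoeff,
      ObservationPattern.jointCount, ObservationPattern.effectCount, mul_zero, sub_zero]
    congr 1
    · refine Finset.sum_congr rfl fun i _ => congrArg _ ?_
      rw [ObservationPattern.rowT, pow_two, Finset.sum_mul_sum]
      exact Finset.sum_congr rfl fun j _ => Finset.sum_congr rfl fun s _ => by ring
    · rw [Finset.sum_comm]
      refine Finset.sum_congr rfl fun j _ => ?_
      rw [Finset.sum_mul]
      exact Finset.sum_congr rfl fun i _ => by ring
  have hBκ : ∑ j ∈ O.cols, (∑ i ∈ O.rows, O.Z i j * (1 - (O.rowCount i)⁻¹))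
      * (O.overallDiag (.inr (.inl j)) - O.overallCoeff (.inr (.inl j)) (.inr (.inl j))) =
      ∑ i ∈ O.rows, ∑ j ∈ O.cols,
        O.Z i j * (O.N - O.colCount j) * O.colCount j * (1 - (O.rowCount i)⁻¹) := by
    rw [Finset.sum_comm]
    refine Finset.sum_congr rfl fun j _ => ?_
    rw [Finset.sum_mul]
    simp only [ObservationPattern.overallDiag, ObservationPattern.overallCoeff,
      ObservationPattern.jointCount, ObservationPattern.effectCount]
    exact Finset.sum_congr rfl fun i _ => by ring
  have hE : (∑ i ∈ O.rows, ∑ j ∈ O.cols, ∑ r ∈ O.rows, ∑ s ∈ O.cols,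
        O.rowCoeff (.inr (.inr (i, j))) (.inr (.inr (r, s)))
          * O.overallCoeff (.inr (.inr (i, j))) (.inr (.inr (r, s))))
      - ∑ i ∈ O.rows, ∑ j ∈ O.cols, O.rowCoeff (.inr (.inr (i, j))) (.inr (.inr (i, j)))
          * O.overallCoeff (.inr (.inr (i, j))) (.inr (.inr (i, j))) = O.N - O.R := by
    rw [O.sum_rowCoeff_error_mul, ← Finset.sum_sub_distrib, ← O.sum_one_sub_inv_mul_rowCount]
    refine Finset.sum_congr rfl fun i hi => ?_
    have h1 : ∑ j ∈ O.cols, ∑ s ∈ O.cols, O.Z i j * O.Z i s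
        * O.overallCoeff (.inr (.inr (i, j))) (.inr (.inr (i, s))) =
        O.rowCount i * O.rowCount i := by
      simp only [ObservationPattern.overallCoeff, ObservationPattern.jointCount,
        ObservationPattern.effectCount, ObservationPattern.rowCount, Finset.sum_mul_sum]
      refine Finset.sum_congr rfl fun j _ => Finset.sum_congr rfl fun s _ => ?_
      linear_combination O.Z i s * O.Z i s * O.Z_mul_self i j + O.Z i j * O.Z_mul_self i s
    have h2 : ∑ j ∈ O.cols, O.rowCoeff (.inr (.inr (i, j))) (.inr (.inr (i, j)))
        * O.overallCoeff (.inr (.inr (i, j))) (.inr (.inr (i, j))) =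
        (O.rowCount i)⁻¹ * O.rowCount i := by
      rw [← hN i hi, Finset.mul_sum, hN i hi]
      refine Finset.sum_congr rfl fun j _ => ?_
      simp only [O.rowCoeff_error_self, ObservationPattern.overallCoeff,
        ObservationPattern.jointCount, ObservationPattern.effectCount]
      linear_combination (O.rowCount i)⁻¹ * (O.Z i j + 1) * O.Z_mul_self i j
    have h0 := O.rowCount_ne_zero hi
    rw [h1, h2]
    field_simp
  have hEκ : ∑ i ∈ O.rows, ∑ j ∈ O.cols, O.Z i j * (1 - (O.rowCount i)⁻¹)
      * (O.overallDiag (.inr (.inr (i, j)))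
        - O.overallCoeff (.inr (.inr (i, j))) (.inr (.inr (i, j)))) =
      (O.N - O.R) * (O.N - 1) := by
    rw [← O.sum_one_sub_inv_mul_rowCount, ← O.sum_Z_mul_row, Finset.sum_mul]
    refine Finset.sum_congr rfl fun i _ => ?_
    rw [Finset.sum_mul]
    refine Finset.sum_congr rfl fun j _ => ?_
    simp only [ObservationPattern.overallDiag, ObservationPattern.overallCoeff,
      ObservationPattern.jointCount, ObservationPattern.effectCount]
    linear_combination (1 - (O.rowCount i)⁻¹) * (O.N - O.Z i j - 1) * O.Z_mul_self i j
  have hBE : ∑ s ∈ O.cols, ∑ i ∈ O.rows, ∑ j ∈ O.cols,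
      O.rowCoeff (.inr (.inl s)) (.inr (.inr (i, j)))
        * O.overallCoeff (.inr (.inl s)) (.inr (.inr (i, j))) = O.N * (O.N - O.R) := by
    rw [O.sum_rowCoeff_col_error_mul, ← O.sum_one_sub_inv_mul_rowCount, Finset.mul_sum]
    refine Finset.sum_congr rfl fun i hi => ?_
    have h1 : ∑ j ∈ O.cols, O.Z i j * O.overallCoeff (.inr (.inl j)) (.inr (.inr (i, j))) =
        O.rowT i - O.N * O.rowCount i := by
      rw [ObservationPattern.rowT, ← hN i hi, Finset.mul_sum, ← Finset.sum_sub_distrib]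
      refine Finset.sum_congr rfl fun j _ => ?_
      simp only [ObservationPattern.overallCoeff, ObservationPattern.jointCount,
        ObservationPattern.effectCount, if_true]
      linear_combination (O.colCount j - O.N) * O.Z_mul_self i j
    have h2 : ∑ s ∈ O.cols, ∑ j ∈ O.cols, O.Z i s * O.Z i j
        * O.overallCoeff (.inr (.inl s)) (.inr (.inr (i, j))) =
        O.rowT i * O.rowCount i - O.N * O.rowCount i := by
      rw [ObservationPattern.rowT, ← hN i hi, Finset.sum_mul_sum, Finset.mul_sum,
        ← Finset.sum_sub_distrib]
      refine Finset.sum_congr rfl fun s hs => ?_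
      have h3 : ∑ j ∈ O.cols, (if j = s then O.N * O.Z i j else 0) = O.N * O.Z i s := by
        simp [hs]
      rw [← h3, ← Finset.sum_sub_distrib]
      refine Finset.sum_congr rfl fun j _ => ?_
      simp only [ObservationPattern.overallCoeff, ObservationPattern.jointCount,
        ObservationPattern.effectCount]
      split_ifs with hjs
      · subst hjs
        linear_combination
          (O.Z i j * O.colCount j - O.N * (O.Z i j + 1)) * O.Z_mul_self i j
      · linear_combination O.Z i s * O.colCount s * O.Z_mul_self i j
    have h0 := O.rowCount_ne_zero hi
    rw [h1, h2]
    field_simp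
    ring
  rw [O.Ua_eq_quadForm hY.response_eq, O.Ue_eq_quadForm hY.response_eq,
    hY.covariance_quadForm O O.rowCoeff_symm O.overallCoeff_symm, hB, hE, hBE]
  simp only [O.rowDiag_sub_rowCoeff_col, O.rowDiag_sub_rowCoeff_error, hBκ, hEκ]
  simp only [ObservationPattern.rowDiag, ObservationPattern.rowCoeff, zero_mul, mul_zero, sub_self,
    Finset.sum_const_zero, zero_add, add_zero]
  ring

theorem variance_Ue (hY : CrossedRandomEffects P Y m a b e vA vB vE κA κB κE)
    (O : ObservationPattern) :
    Var[O.Ue Y; P] =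
      2 * vA ^ 2 * ((∑ i ∈ O.rows, O.rowCount i ^ 2) ^ 2 - ∑ i ∈ O.rows, O.rowCount i ^ 4)
        + vA ^ 2 * (κA + 2) * (O.N ^ 2 * (∑ i ∈ O.rows, O.rowCount i ^ 2)
          - 2 * O.N * (∑ i ∈ O.rows, O.rowCount i ^ 3) + ∑ i ∈ O.rows, O.rowCount i ^ 4)
        + 2 * vB ^ 2 * ((∑ j ∈ O.cols, O.colCount j ^ 2) ^ 2 - ∑ j ∈ O.cols, O.colCount j ^ 4)
        + vB ^ 2 * (κB + 2) * (O.N ^ 2 * (∑ j ∈ O.cols, O.colCount j ^ 2)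
          - 2 * O.N * (∑ j ∈ O.cols, O.colCount j ^ 3) + ∑ j ∈ O.cols, O.colCount j ^ 4)
        + 2 * vE ^ 2 * O.N * (O.N - 1) + vE ^ 2 * (κE + 2) * O.N * (O.N - 1) ^ 2
        + 4 * vA * vB * (O.N ^ 3
          - 2 * O.N * (∑ i ∈ O.rows, ∑ j ∈ O.cols, O.Z i j * O.rowCount i * O.colCount j)
          + ∑ i ∈ O.rows, ∑ j ∈ O.cols, O.rowCount i ^ 2 * O.colCount j ^ 2)
        + 4 * vA * vE * (O.N ^ 3 - O.N * (∑ i ∈ O.rows, O.rowCount i ^ 2))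
        + 4 * vB * vE * (O.N ^ 3 - O.N * (∑ j ∈ O.cols, O.colCount j ^ 2)) := by
  have hN : ∑ i ∈ O.rows, ∑ j ∈ O.cols, O.Z i j = O.N := rfl
  have hsq : ∀ g : ℕ → ℝ, ∀ T : Finset ℕ, ∑ k ∈ T, ∑ l ∈ T, g k * g l * (g k * g l) =
      (∑ k ∈ T, g k ^ 2) ^ 2 := by
    intro g T
    rw [pow_two (∑ k ∈ T, _), Finset.sum_mul_sum]
    exact Finset.sum_congr rfl fun k _ => Finset.sum_congr rfl fun l _ => by ring
  have hdiag : ∀ g : ℕ → ℝ, ∀ T : Finset ℕ, ∑ k ∈ T, g k * g k * (g k * g k) =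
      ∑ k ∈ T, g k ^ 4 := fun g T => Finset.sum_congr rfl fun k _ => by ring
  have hκ : ∀ g : ℕ → ℝ, ∀ T : Finset ℕ,
      ∑ k ∈ T, (O.N * g k - g k * g k) * (O.N * g k - g k * g k) =
      O.N ^ 2 * ∑ k ∈ T, g k ^ 2 - 2 * O.N * ∑ k ∈ T, g k ^ 3 + ∑ k ∈ T, g k ^ 4 := by
    intro g T
    simp only [Finset.mul_sum, ← Finset.sum_sub_distrib, ← Finset.sum_add_distrib]
    exact Finset.sum_congr rfl fun k _ => by ring
  have hE : ∑ i ∈ O.rows, ∑ j ∈ O.cols, ∑ r ∈ O.rows, ∑ s ∈ O.cols,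
      O.Z i j * O.Z r s * (O.Z i j * O.Z r s) = O.N ^ 2 := by
    simp only [mul_mul_mul_comm, O.Z_mul_self]
    simp only [← Finset.mul_sum, ← Finset.sum_mul, hN, pow_two]
  have hEdiag : ∑ i ∈ O.rows, ∑ j ∈ O.cols, O.Z i j * O.Z i j * (O.Z i j * O.Z i j) = O.N := by
    simp only [O.Z_mul_self, hN]
  have hEκ : ∑ i ∈ O.rows, ∑ j ∈ O.cols, (O.N * O.Z i j - O.Z i j * O.Z i j)
      * (O.N * O.Z i j - O.Z i j * O.Z i j) = O.N * (O.N - 1) ^ 2 := by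
    rw [← hN, Finset.sum_mul, hN]
    refine Finset.sum_congr rfl fun i _ => ?_
    rw [Finset.sum_mul]
    refine Finset.sum_congr rfl fun j _ => ?_
    rw [O.Z_mul_self]
    linear_combination (O.N - 1) ^ 2 * O.Z_mul_self i j
  have hAB : ∑ i ∈ O.rows, ∑ j ∈ O.cols, (O.rowCount i * O.colCount j - O.N * O.Z i j)
      * (O.rowCount i * O.colCount j - O.N * O.Z i j) =
      O.N ^ 3 - 2 * O.N * (∑ i ∈ O.rows, ∑ j ∈ O.cols, O.Z i j * O.rowCount i * O.colCount j)
        + ∑ i ∈ O.rows, ∑ j ∈ O.cols, O.rowCount i ^ 2 * O.colCount j ^ 2 := by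
    have h3 : O.N ^ 3 = ∑ i ∈ O.rows, ∑ j ∈ O.cols, O.N ^ 2 * O.Z i j := by
      simp only [← Finset.mul_sum, hN]
      ring
    rw [h3]
    simp only [Finset.mul_sum, ← Finset.sum_sub_distrib, ← Finset.sum_add_distrib]
    refine Finset.sum_congr rfl fun i _ => Finset.sum_congr rfl fun j _ => ?_
    linear_combination O.N ^ 2 * O.Z_mul_self i j
  have hAE : ∑ r ∈ O.rows, ∑ i ∈ O.rows, ∑ j ∈ O.cols,
      (O.rowCount r * O.Z i j - O.N * if i = r then O.Z i j else 0)
        * (O.rowCount r * O.Z i j - O.N * if i = r then O.Z i j else 0) =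
      O.N ^ 3 - O.N * ∑ i ∈ O.rows, O.rowCount i ^ 2 := by
    have h1 : ∀ r ∈ O.rows, ∑ i ∈ O.rows, ∑ j ∈ O.cols,
        (O.rowCount r * O.Z i j - O.N * if i = r then O.Z i j else 0)
          * (O.rowCount r * O.Z i j - O.N * if i = r then O.Z i j else 0) =
        O.N ^ 2 * O.rowCount r - O.N * O.rowCount r ^ 2 := by
      intro r hr
      have h2 : ∀ i j, (O.rowCount r * O.Z i j - O.N * if i = r then O.Z i j else 0)
          * (O.rowCount r * O.Z i j - O.N * if i = r then O.Z i j else 0) =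
          O.rowCount r ^ 2 * O.Z i j
            + if i = r then (O.N ^ 2 - 2 * O.N * O.rowCount r) * O.Z i j else 0 := by
        intro i j
        split_ifs
        · linear_combination (O.rowCount r - O.N) ^ 2 * O.Z_mul_self i j
        · linear_combination O.rowCount r ^ 2 * O.Z_mul_self i j
      simp only [h2, Finset.sum_add_distrib, ← Finset.mul_sum, hN, Finset.sum_ite_irrel,
        Finset.sum_const_zero, Finset.sum_ite_eq', hr, if_true]
      rw [show ∑ j ∈ O.cols, O.Z r j = O.rowCount r from rfl]
      ring
    rw [Finset.sum_congr rfl h1, Finset.sum_sub_distrib, ← Finset.mul_sum, ← Finset.mul_sum,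
      O.sum_rowCount]
    ring
  have hBE : ∑ s ∈ O.cols, ∑ i ∈ O.rows, ∑ j ∈ O.cols,
      (O.colCount s * O.Z i j - O.N * if j = s then O.Z i j else 0)
        * (O.colCount s * O.Z i j - O.N * if j = s then O.Z i j else 0) =
      O.N ^ 3 - O.N * ∑ j ∈ O.cols, O.colCount j ^ 2 := by
    have h1 : ∀ s ∈ O.cols, ∑ i ∈ O.rows, ∑ j ∈ O.cols,
        (O.colCount s * O.Z i j - O.N * if j = s then O.Z i j else 0)
          * (O.colCount s * O.Z i j - O.N * if j = s then O.Z i j else 0) =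
        O.N ^ 2 * O.colCount s - O.N * O.colCount s ^ 2 := by
      intro s hs
      have h2 : ∀ i j, (O.colCount s * O.Z i j - O.N * if j = s then O.Z i j else 0)
          * (O.colCount s * O.Z i j - O.N * if j = s then O.Z i j else 0) =
          O.colCount s ^ 2 * O.Z i j
            + if j = s then (O.N ^ 2 - 2 * O.N * O.colCount s) * O.Z i j else 0 := by
        intro i j
        split_ifs
        · linear_combination (O.colCount s - O.N) ^ 2 * O.Z_mul_self i j
        · linear_combination O.colCount s ^ 2 * O.Z_mul_self i j
      simp only [h2, Finset.sum_add_distrib, ← Finset.mul_sum, hN, Finset.sum_ite_eq', hs, if_true]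
      rw [show ∑ i ∈ O.rows, O.Z i s = O.colCount s from rfl]
      ring
    rw [Finset.sum_congr rfl h1, Finset.sum_sub_distrib, ← Finset.mul_sum, ← Finset.mul_sum,
      O.sum_colCount]
    ring
  rw [← covariance_self (hY.memLp_Ue O).aestronglyMeasurable.aemeasurable,
    O.Ue_eq_quadForm hY.response_eq, hY.covariance_quadForm O O.overallCoeff_symm
      O.overallCoeff_symm]
  simp only [ObservationPattern.overallDiag, ObservationPattern.overallCoeff,
    ObservationPattern.jointCount, ObservationPattern.effectCount, mul_zero, sub_zero, hE,
    hEdiag, hEκ, hAB, hAE, hBE]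
  simp only [hsq, hdiag, hκ]
  ring

end CrossedRandomEffects

theorem theorem2 {Ω : Type*} [MeasurableSpace Ω] (P : Measure Ω) [IsProbabilityMeasure P]
    (O : ObservationPattern)
    (Y : ℕ → ℕ → Ω → ℝ) (m : ℝ) (a b : ℕ → Ω → ℝ) (e : ℕ → ℕ → Ω → ℝ)
    (vA vB vE κA κB κE : ℝ)
    (hY : CrossedRandomEffects P Y m a b e vA vB vE κA κB κE) :
    -- the three statistics are square integrable
    (MemLp (O.Ua Y) 2 P ∧ MemLp (O.Ub Y) 2 P ∧ MemLp (O.Ue Y) 2 P) ∧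
    -- variance of `Ua`
    Var[O.Ua Y; P] =
      vB ^ 2 * (κB + 2) * (∑ i ∈ O.rows, ∑ r ∈ O.rows,
          O.ZZt i r * (1 - (O.rowCount i)⁻¹) * (1 - (O.rowCount r)⁻¹))
        + 2 * vB ^ 2 * (∑ i ∈ O.rows, ∑ r ∈ O.rows,
          (O.rowCount i)⁻¹ * (O.rowCount r)⁻¹ * (O.ZZt i r * (O.ZZt i r - 1)))
        + 4 * vB * vE * (O.N - O.R)
        + vE ^ 2 * (κE + 2) * (∑ i ∈ O.rows, O.rowCount i * (1 - (O.rowCount i)⁻¹) ^ 2)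
        + 2 * vE ^ 2 * (∑ i ∈ O.rows, (1 - (O.rowCount i)⁻¹)) ∧
    -- variance of `Ub`
    Var[O.Ub Y; P] =
      vA ^ 2 * (κA + 2) * (∑ j ∈ O.cols, ∑ s ∈ O.cols,
          O.ZtZ j s * (1 - (O.colCount j)⁻¹) * (1 - (O.colCount s)⁻¹))
        + 2 * vA ^ 2 * (∑ j ∈ O.cols, ∑ s ∈ O.cols,
          (O.colCount j)⁻¹ * (O.colCount s)⁻¹ * (O.ZtZ j s * (O.ZtZ j s - 1)))
        + 4 * vA * vE * (O.N - O.C)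
        + vE ^ 2 * (κE + 2) * (∑ j ∈ O.cols, O.colCount j * (1 - (O.colCount j)⁻¹) ^ 2)
        + 2 * vE ^ 2 * (∑ j ∈ O.cols, (1 - (O.colCount j)⁻¹)) ∧
    -- variance of `Ue`
    Var[O.Ue Y; P] =
      2 * vA ^ 2 * ((∑ i ∈ O.rows, O.rowCount i ^ 2) ^ 2 - ∑ i ∈ O.rows, O.rowCount i ^ 4)
        + vA ^ 2 * (κA + 2) * (O.N ^ 2 * (∑ i ∈ O.rows, O.rowCount i ^ 2)
          - 2 * O.N * (∑ i ∈ O.rows, O.rowCount i ^ 3) + ∑ i ∈ O.rows, O.rowCount i ^ 4)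
        + 2 * vB ^ 2 * ((∑ j ∈ O.cols, O.colCount j ^ 2) ^ 2 - ∑ j ∈ O.cols, O.colCount j ^ 4)
        + vB ^ 2 * (κB + 2) * (O.N ^ 2 * (∑ j ∈ O.cols, O.colCount j ^ 2)
          - 2 * O.N * (∑ j ∈ O.cols, O.colCount j ^ 3) + ∑ j ∈ O.cols, O.colCount j ^ 4)
        + 2 * vE ^ 2 * O.N * (O.N - 1) + vE ^ 2 * (κE + 2) * O.N * (O.N - 1) ^ 2
        + 4 * vA * vB * (O.N ^ 3
          - 2 * O.N * (∑ i ∈ O.rows, ∑ j ∈ O.cols, O.Z i j * O.rowCount i * O.colCount j)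
          + ∑ i ∈ O.rows, ∑ j ∈ O.cols, O.rowCount i ^ 2 * O.colCount j ^ 2)
        + 4 * vA * vE * (O.N ^ 3 - O.N * (∑ i ∈ O.rows, O.rowCount i ^ 2))
        + 4 * vB * vE * (O.N ^ 3 - O.N * (∑ j ∈ O.cols, O.colCount j ^ 2)) ∧
    -- covariance of `Ua` and `Ub`
    cov[O.Ua Y, O.Ub Y; P] =
      vE ^ 2 * (κE + 2) * (∑ i ∈ O.rows, ∑ j ∈ O.cols,
        O.Z i j * (1 - (O.rowCount i)⁻¹) * (1 - (O.colCount j)⁻¹)) ∧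
    -- covariance of `Ua` and `Ue`
    cov[O.Ua Y, O.Ue Y; P] =
      2 * vB ^ 2 * ((∑ i ∈ O.rows, (O.rowCount i)⁻¹ * O.rowT i ^ 2)
          - ∑ i ∈ O.rows, ∑ j ∈ O.cols, O.Z i j * (O.rowCount i)⁻¹ * O.colCount j ^ 2)
        + vB ^ 2 * (κB + 2) * (∑ i ∈ O.rows, ∑ j ∈ O.cols,
          O.Z i j * (O.N - O.colCount j) * O.colCount j * (1 - (O.rowCount i)⁻¹))
        + 2 * vE ^ 2 * (O.N - O.R) + vE ^ 2 * (κE + 2) * (O.N - O.R) * (O.N - 1)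
        + 4 * vB * vE * O.N * (O.N - O.R) ∧
    -- covariance of `Ub` and `Ue`
    cov[O.Ub Y, O.Ue Y; P] =
      2 * vA ^ 2 * ((∑ j ∈ O.cols, (O.colCount j)⁻¹ * O.colT j ^ 2)
          - ∑ i ∈ O.rows, ∑ j ∈ O.cols, O.Z i j * (O.colCount j)⁻¹ * O.rowCount i ^ 2)
        + vA ^ 2 * (κA + 2) * (∑ i ∈ O.rows, ∑ j ∈ O.cols,
          O.Z i j * (O.N - O.rowCount i) * O.rowCount i * (1 - (O.colCount j)⁻¹))
        + 2 * vE ^ 2 * (O.N - O.C) + vE ^ 2 * (κE + 2) * (O.N - O.C) * (O.N - 1)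
        + 4 * vA * vE * O.N * (O.N - O.C) := by
  have hT := hY.transpose
  refine ⟨⟨hY.memLp_Ua O, ?_, hY.memLp_Ue O⟩, hY.variance_Ua O, ?_, hY.variance_Ue O,
    hY.covariance_Ua_Ub O, hY.covariance_Ua_Ue O, ?_⟩
  · rw [← O.transpose_Ua]
    exact hT.memLp_Ua O.transpose
  · rw [← O.transpose_Ua, hT.variance_Ua O.transpose]
    simp only [O.transpose_rows, O.transpose_ZZt, O.transpose_rowCount, O.transpose_N,
      O.transpose_R]
  · rw [← O.transpose_Ua, ← O.transpose_Ue, hT.covariance_Ua_Ue O.transpose]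
    simp only [O.transpose_rows, O.transpose_cols, O.transpose_Z, O.transpose_rowCount,
      O.transpose_colCount, O.transpose_rowT, O.transpose_N, O.transpose_R]
    rw [Finset.sum_comm (s := O.cols) (t := O.rows), Finset.sum_comm (s := O.cols) (t := O.rows)]
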